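/- Let $G$ be a simply connected solvable complex Lie group (of finite dimension) and let $\Gamma\subset G$ be a lattice, that is, a discrete subgroup such that the quotient $G/\Gamma$ is compact. Equip $G/\Gamma$ with the complex structure for which the projection $G\to G/\Gamma$ is locally biholomorphic; such a $G/\Gamma$ is called a complex parallelizable solvmanifold. Suppose that $G$ is not nilpotent. Then $G/\Gamma$ admits no SKT (strong Kähler with torsion) structure: there is no smooth Hermitian metric $g$ on the complex manifold $G/\Gamma$ (invariant or not), with complex structure $J$, whose fundamental form $\omega(X,Y)=g(JX,Y)$ satisfies $\partial\bar\partial\omega=0$. -/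

import Mathlib

open scoped Manifold ContDiff Topology

noncomputable section

/-! ### Complex manifolds as real manifolds -/

/-- A complex manifold modelled on `E` is a real manifold modelled on `E`. -/
instance isManifold_real_of_complex {E : Type*} [NormedAddCommGroup E] [NormedSpace ℂ E]
    {M : Type*} [TopologicalSpace M] [ChartedSpace E M] {n : WithTop ℕ∞}
    [IsManifold 𝓘(ℂ, E) n M] : IsManifold 𝓘(ℝ, E) n M := by
  apply isManifold_of_contDiffOn
  intro e e' he he'
  have h := (contDiffGroupoid n 𝓘(ℂ, E)).compatible he he'
  have h1 := (contMDiffOn_of_mem_contDiffGroupoid h).contDiffOn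
  simpa using h1.restrict_scalars ℝ

/-- Multiplication by `i` on a complex normed space, as a real linear map. -/
def mulI (E : Type*) [NormedAddCommGroup E] [NormedSpace ℂ E] : E →L[ℝ] E :=
  Complex.I • ContinuousLinearMap.id ℝ E

/-- The complex structure `J` on the real tangent space at `x` of a complex manifold. The tangent
space is identified with the model space `E` through the preferred chart at `x`; as this chart is
holomorphic, `J` is multiplication by `i`. -/
def tangentJ {E : Type*} [NormedAddCommGroup E] [NormedSpace ℂ E]
    {M : Type*} [TopologicalSpace M] [ChartedSpace E M] (x : M) :
    TangentSpace 𝓘(ℝ, E) x →L[ℝ] TangentSpace 𝓘(ℝ, E) x :=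
  mulI E

/-! ### The operators `∂` and `∂̄` on complex-valued forms -/

section Dolbeault

variable {E : Type*} [NormedAddCommGroup E] [NormedSpace ℂ E]

/-- The complex linear part of a real linear map between complex spaces. -/
def linearPart {F : Type*} [NormedAddCommGroup F] [NormedSpace ℂ F] (L : E →L[ℝ] F) :
    E →L[ℝ] F :=
  (1 / 2 : ℂ) • (L - Complex.I • L ∘L mulI E)

/-- The complex antilinear part of a real linear map between complex spaces. -/
def antilinearPart {F : Type*} [NormedAddCommGroup F] [NormedSpace ℂ F] (L : E →L[ℝ] F) :
    E →L[ℝ] F :=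
  (1 / 2 : ℂ) • (L + Complex.I • L ∘L mulI E)

/-- The operator `∂` on complex-valued `k`-forms on (open subsets of) a complex vector space:
only the complex linear part `∂f` of the differential of each coefficient `f` is used in the
formula for the exterior derivative, so `∂ (f dz_I ∧ dz̄_J) = ∂f ∧ dz_I ∧ dz̄_J`. -/
def formDel {k : ℕ} (α : E → E [⋀^Fin k]→L[ℝ] ℂ) (x : E) : E [⋀^Fin (k + 1)]→L[ℝ] ℂ :=
  .alternatizeUncurryFin (linearPart (fderiv ℝ α x))

/-- The operator `∂̄` on complex-valued `k`-forms on (open subsets of) a complex vector space: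
`∂̄ (f dz_I ∧ dz̄_J) = ∂̄f ∧ dz_I ∧ dz̄_J`. -/
def formDelBar {k : ℕ} (α : E → E [⋀^Fin k]→L[ℝ] ℂ) (x : E) : E [⋀^Fin (k + 1)]→L[ℝ] ℂ :=
  .alternatizeUncurryFin (antilinearPart (fderiv ℝ α x))

end Dolbeault

/-! ### Hermitian metrics and SKT metrics -/

section Hermitian

variable (E : Type*) [NormedAddCommGroup E] [NormedSpace ℂ E]
  (M : Type*) [TopologicalSpace M] [ChartedSpace E M] [IsManifold 𝓘(ℂ, E) ω M]

/-- A Hermitian metric on a complex manifold: a smooth Riemannian metric `g` with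
`g (J v, J w) = g (v, w)`. -/
structure HermitianMetric extends
    Bundle.ContMDiffRiemannianMetric 𝓘(ℝ, E) ∞ E (fun x : M => TangentSpace 𝓘(ℝ, E) x) where
  inner_J (x : M) (v w : TangentSpace 𝓘(ℝ, E) x) :
    inner x (tangentJ x v) (tangentJ x w) = inner x v w

variable {E M}

theorem HermitianMetric.inner_J_self (g : HermitianMetric E M) (x : M)
    (v : TangentSpace 𝓘(ℝ, E) x) : g.inner x (tangentJ x v) v = 0 := by
  have hJ : tangentJ x (tangentJ x v) = -v := by
    have h (u : E) : Complex.I • (Complex.I • u) = -u := by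
      rw [smul_smul, Complex.I_mul_I, neg_one_smul]
    exact h v
  have h1 := g.inner_J x (tangentJ x v) v
  rw [hJ, map_neg, neg_apply, g.symm x v] at h1
  linarith

/-- The fundamental form `ω (v, w) = g (J v, w)` of a Hermitian metric. -/
def HermitianMetric.fundamentalForm (g : HermitianMetric E M) (x : M) :
    TangentSpace 𝓘(ℝ, E) x [⋀^Fin 2]→L[ℝ] ℝ where
  toFun v := g.inner x (tangentJ x (v 0)) (v 1)
  map_update_add' v i a b := by
    fin_cases i <;> simp
  map_update_smul' v i c a := by
    fin_cases i <;> simp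
  map_eq_zero_of_eq' v i j hv hij := by
    have h : v 0 = v 1 := by
      fin_cases i <;> fin_cases j <;> simp_all
    rw [h]
    exact g.inner_J_self x (v 1)
  cont := by
    have h (B : E →L[ℝ] E →L[ℝ] ℝ) : Continuous fun v : Fin 2 → E => B (v 0) (v 1) := by
      fun_prop
    exact h (g.inner x ∘L tangentJ x)

/-- The fundamental form read in the chart `e`, i.e. its pullback under `e.symm`, as a
complex-valued form on the open subset `e.target` of `E`. -/
def HermitianMetric.fundamentalFormInChart (g : HermitianMetric E M)
    (e : OpenPartialHomeomorph M E) (y : E) : E [⋀^Fin 2]→L[ℝ] ℂ :=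
  Complex.ofRealCLM.compContinuousAlternatingMap
    ((g.fundamentalForm (e.symm y)).compContinuousLinearMap
      (mfderiv 𝓘(ℝ, E) 𝓘(ℝ, E) e.symm y))

/-- A Hermitian metric is strong Kähler with torsion (SKT) if its fundamental form is
`∂∂̄`-closed: `∂∂̄ω = 0` in every holomorphic chart. -/
def HermitianMetric.IsSKT (g : HermitianMetric E M) : Prop :=
  ∀ e ∈ IsManifold.maximalAtlas 𝓘(ℂ, E) ω M, ∀ y ∈ e.target,
    formDel (formDelBar (g.fundamentalFormInChart e)) y = 0

end Hermitian

/-! ### The complex manifold `G ⧸ Γ` -/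

section Quotient

variable {E : Type*} [NormedAddCommGroup E] [NormedSpace ℂ E]
  {G : Type*} [Group G] [TopologicalSpace G] [ChartedSpace E G]

/-- The projection `G → G ⧸ Γ` onto the quotient by a discrete subgroup is a local
homeomorphism. -/
theorem isLocalHomeomorph_quotientGroup_mk [IsTopologicalGroup G]
    (Γ : Subgroup G) [DiscreteTopology Γ] :
    IsLocalHomeomorph (QuotientGroup.mk : G → G ⧸ Γ) :=
  (Γ.isQuotientCoveringMap ⟨inferInstance⟩).isCoveringMap.isLocalHomeomorph

variable [LieGroup 𝓘(ℂ, E) ω G] (Γ : Subgroup G) [DiscreteTopology Γ]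

/-- The charts of `G ⧸ Γ`, for a discrete subgroup `Γ` of a complex Lie group `G`: local inverses
of the projection `G → G ⧸ Γ` followed by charts of `G`. -/
instance quotientChartedSpace : ChartedSpace E (G ⧸ Γ) :=
  have := topologicalGroup_of_lieGroup (G := G) 𝓘(ℂ, E) ω
  (isLocalHomeomorph_quotientGroup_mk Γ).chartedSpace QuotientGroup.mk_surjective

/-- `G ⧸ Γ` is a complex manifold: its transition maps are, locally, right translations by
elements of `Γ` read in charts of `G`. -/
instance quotientIsManifold : IsManifold 𝓘(ℂ, E) ω (G ⧸ Γ) := by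
  have := topologicalGroup_of_lieGroup (G := G) 𝓘(ℂ, E) ω
  have hf := isLocalHomeomorph_quotientGroup_mk Γ
  have key : ∀ a b : G, ContDiffOn ℂ ω
      (((hf.localInverseAt a).trans (chartAt E a)).symm.trans
        ((hf.localInverseAt b).trans (chartAt E b)))
      (((hf.localInverseAt a).trans (chartAt E a)).symm.trans
        ((hf.localInverseAt b).trans (chartAt E b))).source := by
    intro a b y hy
    simp only [OpenPartialHomeomorph.trans_source, OpenPartialHomeomorph.symm_source,
      OpenPartialHomeomorph.trans_target, OpenPartialHomeomorph.coe_trans_symm, Set.mem_inter_iff,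
      Set.mem_preimage, Function.comp_apply, hf.localInverseAt_symm] at hy
    obtain ⟨⟨hya, hpa⟩, hpb, hqb⟩ := hy
    set p : G := (chartAt E a).symm y with hp
    set q : G := hf.localInverseAt b (QuotientGroup.mk p) with hq
    have hqt : q ∈ (hf.localInverseAt b).target := (hf.localInverseAt b).map_source hpb
    have hfq : (QuotientGroup.mk p : G ⧸ Γ) = QuotientGroup.mk q :=
      (hf.apply_localInverseAt_of_mem hpb).symm
    have hγ : p⁻¹ * q ∈ Γ := QuotientGroup.eq.1 hfq
    set γ : G := p⁻¹ * q with hγdef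
    have hpγ : p * γ = q := by simp [hγdef]
    have hsymm : ContMDiffAt 𝓘(ℂ, E) 𝓘(ℂ, E) ω (chartAt E a).symm y :=
      contMDiffAt_symm_of_mem_maximalAtlas (IsManifold.chart_mem_maximalAtlas a) hya
    have hmul : ContMDiffAt 𝓘(ℂ, E) 𝓘(ℂ, E) ω (fun z => (chartAt E a).symm z * γ) y :=
      (contMDiff_mul_right (I := 𝓘(ℂ, E)) (n := ω) (a := γ)).contMDiffAt.comp y hsymm
    have hchart : ContMDiffAt 𝓘(ℂ, E) 𝓘(ℂ, E) ω (chartAt E b) ((chartAt E a).symm y * γ) :=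
      contMDiffAt_of_mem_maximalAtlas (IsManifold.chart_mem_maximalAtlas b)
        (by rw [← hp, hpγ]; exact hqb)
    have hcomp : ContDiffAt ℂ ω (fun z => chartAt E b ((chartAt E a).symm z * γ)) y :=
      (hchart.comp y hmul).contDiffAt
    refine (hcomp.congr_of_eventuallyEq ?_).contDiffWithinAt
    have hnhds : ∀ᶠ z in 𝓝 y, (chartAt E a).symm z * γ ∈ (hf.localInverseAt b).target :=
      hmul.continuousAt.eventually_mem ((hf.localInverseAt b).open_target.mem_nhds
        (by rw [← hp, hpγ]; exact hqt))
    filter_upwards [hnhds] with z hz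
    have h1 : (QuotientGroup.mk ((chartAt E a).symm z) : G ⧸ Γ) =
        (hf.localInverseAt b).symm ((chartAt E a).symm z * γ) := by
      rw [hf.localInverseAt_symm]
      exact (QuotientGroup.mk_mul_of_mem _ hγ).symm
    have h2 : hf.localInverseAt b (QuotientGroup.mk ((chartAt E a).symm z)) =
        (chartAt E a).symm z * γ := by
      rw [h1, (hf.localInverseAt b).right_inv hz]
    simp [h2]
  apply isManifold_of_contDiffOn
  rintro _ _ ⟨a, rfl⟩ ⟨b, rfl⟩
  simpa using key _ _

end Quotient

end

/-!
An SKT metric on `G ⧸ Γ` forces `G` to be abelian, hence nilpotent.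

For a point `p` of `G ⧸ Γ`, the orbit map `x ↦ x • p` is a holomorphic local diffeomorphism
`G → G ⧸ Γ`, so the fundamental form pulls back to a `∂∂̄`-closed positive `(1,1)`-form on `G`. The
compact quotient carries a nonzero finite `G`-invariant measure
(`exists_finite_smulInvariant_measure`), over which these forms are averaged in `p`. The average is
still `∂∂̄`-closed and positive, and it is invariant under right translations of `G`
(`HermitianMetric.averagedForm_fderivLeft`): in the holomorphic frame of right invariant vector
fields its coefficients are constant. All this is needed near the neutral element only, and it is
carried out in the preferred chart of `G` there.

A `(1,1)`-form with constant coefficients `B` in a holomorphic coframe `A`, where `A x = 1`,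
satisfies
`∂∂̄ (B (A ·, A ·)) (u, v, iu, iv) = 2i B (T, iT)` at `x`, with the torsion `T = A' u v - A' v u`
(`formDel_formDelBar_of_holomorphic`). As `B` is positive, `T = 0`. For the right invariant coframe
the torsion is the Lie bracket of `u` and `v` up to sign, so the second order term of the group law
is symmetric.

Then the derivative of `Ad` vanishes at the neutral element, hence near it because `Ad` is
multiplicative, and `Ad` is trivial there; the same argument, applied to conjugation itself, shows
that conjugation is trivial near the neutral element (`IsLocalGroupLaw.conj_eq_of_symm`). So
elements near `1` commute, and a connected group is generated by any neighborhood of `1`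
(`mul_comm_of_symm`).
-/

noncomputable section

set_option maxSynthPendingDepth 3

/-! ### The operator `∂∂̄` on two-forms -/

section DelDelBar

variable {E : Type*} [NormedAddCommGroup E] [NormedSpace ℂ E]

/-- `linearPart` as a continuous linear map. -/
def linearPartCLM (E F : Type*) [NormedAddCommGroup E] [NormedSpace ℂ E]
    [NormedAddCommGroup F] [NormedSpace ℂ F] : (E →L[ℝ] F) →L[ℝ] (E →L[ℝ] F) :=
  (1 / 2 : ℂ) • (ContinuousLinearMap.id ℝ _ -
    Complex.I • (ContinuousLinearMap.compL ℝ E E F).flip (mulI E))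

/-- `antilinearPart` as a continuous linear map. -/
def antilinearPartCLM (E F : Type*) [NormedAddCommGroup E] [NormedSpace ℂ E]
    [NormedAddCommGroup F] [NormedSpace ℂ F] : (E →L[ℝ] F) →L[ℝ] (E →L[ℝ] F) :=
  (1 / 2 : ℂ) • (ContinuousLinearMap.id ℝ _ +
    Complex.I • (ContinuousLinearMap.compL ℝ E E F).flip (mulI E))

/-- The value of `∂∂̄α` at a point as a continuous linear function of the second derivative of the
two-form `α` at that point. -/
def delDelBarCLM (E : Type*) [NormedAddCommGroup E] [NormedSpace ℂ E] :
    (E →L[ℝ] E →L[ℝ] E [⋀^Fin 2]→L[ℝ] ℂ) →L[ℝ] E [⋀^Fin 4]→L[ℝ] ℂ :=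
  ContinuousAlternatingMap.alternatizeUncurryFinCLM ℝ E ℂ ∘L linearPartCLM E _ ∘L
    ContinuousLinearMap.compL ℝ E (E →L[ℝ] E [⋀^Fin 2]→L[ℝ] ℂ) (E [⋀^Fin 3]→L[ℝ] ℂ)
      (ContinuousAlternatingMap.alternatizeUncurryFinCLM ℝ E ℂ ∘L antilinearPartCLM E _)

theorem formDel_formDelBar_eq {α : E → E [⋀^Fin 2]→L[ℝ] ℂ} {x : E} (hα : ContDiffAt ℝ 2 α x) :
    formDel (formDelBar α) x = delDelBarCLM E (fderiv ℝ (fderiv ℝ α) x) := by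
  have hd : DifferentiableAt ℝ (fderiv ℝ α) x :=
    (hα.fderiv_right (m := 1) (by norm_num)).differentiableAt (by norm_num)
  have h : formDelBar α = fun y => (ContinuousAlternatingMap.alternatizeUncurryFinCLM ℝ E ℂ ∘L
      antilinearPartCLM E _) (fderiv ℝ α y) := rfl
  have h2 : HasFDerivAt (fun y => (ContinuousAlternatingMap.alternatizeUncurryFinCLM ℝ E ℂ ∘L
      antilinearPartCLM E _) (fderiv ℝ α y)) _ x :=
    (ContinuousLinearMap.hasFDerivAt _).comp x hd.hasFDerivAt
  rw [formDel, h, h2.fderiv]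
  rfl

theorem fderiv_fderiv_clm_comp {F G : Type*} [NormedAddCommGroup F] [NormedSpace ℝ F]
    [NormedAddCommGroup G] [NormedSpace ℝ G] (L : F →L[ℝ] G) {α : E → F} {x : E}
    (hα : ContDiffAt ℝ 2 α x) (p q : E) :
    fderiv ℝ (fderiv ℝ fun w => L (α w)) x p q = L (fderiv ℝ (fderiv ℝ α) x p q) := by
  have hd : DifferentiableAt ℝ (fderiv ℝ α) x :=
    (hα.fderiv_right (m := 1) (by norm_num)).differentiableAt (by norm_num)
  have h : fderiv ℝ (fun w => L (α w)) =ᶠ[𝓝 x]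
      fun w => ContinuousLinearMap.compL ℝ E F G L (fderiv ℝ α w) := by
    filter_upwards [hα.eventually (by simp)] with w hw
    exact (L.hasFDerivAt.comp w (hw.differentiableAt (by norm_num)).hasFDerivAt).fderiv
  have h2 : HasFDerivAt (fun w => ContinuousLinearMap.compL ℝ E F G L (fderiv ℝ α w)) _ x :=
    (ContinuousLinearMap.hasFDerivAt _).comp x hd.hasFDerivAt
  rw [h.fderiv_eq, h2.fderiv]
  rfl

theorem fderiv_restrictScalars_eventuallyEq {F : Type*} [NormedAddCommGroup F] [NormedSpace ℂ F]
    {f : E → F} {x : E} (hf : ContDiffAt ℂ 2 f x) :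
    fderiv ℝ f =ᶠ[𝓝 x] fun w => (fderiv ℂ f w).restrictScalars ℝ := by
  filter_upwards [hf.eventually (by simp)] with w hw
  exact ((hw.differentiableAt (by norm_num)).hasFDerivAt.restrictScalars ℝ).fderiv

/-- The second real derivative of a holomorphic map is complex bilinear. -/
theorem fderiv_fderiv_restrictScalars {F : Type*} [NormedAddCommGroup F] [NormedSpace ℂ F]
    {f : E → F} {x : E} (hf : ContDiffAt ℂ 2 f x) (p q : E) :
    fderiv ℝ (fderiv ℝ f) x p q = fderiv ℂ (fderiv ℂ f) x p q := by
  have hd : DifferentiableAt ℂ (fderiv ℂ f) x :=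
    (hf.fderiv_right (m := 1) (by norm_num)).differentiableAt (by norm_num)
  have h2 : HasFDerivAt (fun w => (fderiv ℂ f w).restrictScalars ℝ) _ x :=
    ((ContinuousLinearMap.restrictScalarsL ℂ E F ℝ ℝ).hasFDerivAt).comp x
      (hd.hasFDerivAt.restrictScalars ℝ)
  rw [(fderiv_restrictScalars_eventuallyEq hf).fderiv_eq, h2.fderiv]
  rfl

theorem fderiv_fderiv_bilinear {F G H : Type*} [NormedAddCommGroup F] [NormedSpace ℝ F]
    [NormedAddCommGroup G] [NormedSpace ℝ G] [NormedAddCommGroup H] [NormedSpace ℝ H]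
    (b : F →L[ℝ] G →L[ℝ] H) {f : E → F} {g : E → G} {x : E}
    (hf : ContDiffAt ℝ 2 f x) (hg : ContDiffAt ℝ 2 g x) (p q : E) :
    fderiv ℝ (fderiv ℝ fun w => b (f w) (g w)) x p q =
      b (fderiv ℝ (fderiv ℝ f) x p q) (g x) + b (fderiv ℝ f x q) (fderiv ℝ g x p) +
      b (fderiv ℝ f x p) (fderiv ℝ g x q) + b (f x) (fderiv ℝ (fderiv ℝ g) x p q) := by
  have h1 {w : E} (hfw : ContDiffAt ℝ 2 f w) (hgw : ContDiffAt ℝ 2 g w) :=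
    b.hasFDerivAt_of_bilinear (hfw.differentiableAt (by norm_num)).hasFDerivAt
      (hgw.differentiableAt (by norm_num)).hasFDerivAt
  have hdf : HasFDerivAt (fderiv ℝ f) _ x :=
    ((hf.fderiv_right (m := 1) (by norm_num)).differentiableAt (by norm_num)).hasFDerivAt
  have hdg : HasFDerivAt (fderiv ℝ g) _ x :=
    ((hg.fderiv_right (m := 1) (by norm_num)).differentiableAt (by norm_num)).hasFDerivAt
  have h : fderiv ℝ (fun w => b (f w) (g w)) =ᶠ[𝓝 x] fun w =>
      b.precompR E (f w) (fderiv ℝ g w) + b.precompL E (fderiv ℝ f w) (g w) := by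
    filter_upwards [hf.eventually (by simp), hg.eventually (by simp)] with w hfw hgw
    exact (h1 hfw hgw).fderiv
  rw [h.fderiv_eq]
  have hf' := (hf.differentiableAt (by norm_num)).hasFDerivAt
  have hg' := (hg.differentiableAt (by norm_num)).hasFDerivAt
  have h2 : HasFDerivAt (fun w => b.precompR E (f w) (fderiv ℝ g w) +
      b.precompL E (fderiv ℝ f w) (g w)) _ x :=
    ((b.precompR E).hasFDerivAt_of_bilinear hf' hdg).add
      ((b.precompL E).hasFDerivAt_of_bilinear hdf hg')
  rw [h2.fderiv]
  simp [ContinuousLinearMap.precompR_apply, ContinuousLinearMap.precompL_apply]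
  abel

/-- The coefficient of `∂∂̄α` obtained by differentiating the value of `α` at `s`, `t` in the
direction `q` (antilinear part) and then in the direction `p` (linear part); `H` is the second
derivative of `α`. -/
def delDelBarTerm (H : E →L[ℝ] E →L[ℝ] E [⋀^Fin 2]→L[ℝ] ℂ) (p q s t : E) : ℂ :=
  (1 / 4 : ℂ) * (H p q ![s, t] + Complex.I * H p (Complex.I • q) ![s, t] -
    Complex.I * H (Complex.I • p) q ![s, t] + H (Complex.I • p) (Complex.I • q) ![s, t])

theorem delDelBarCLM_apply (H : E →L[ℝ] E →L[ℝ] E [⋀^Fin 2]→L[ℝ] ℂ) (x y z w : E) :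
    delDelBarCLM E H ![x, y, z, w] =
      delDelBarTerm H x y z w - delDelBarTerm H x z y w + delDelBarTerm H x w y z
      - (delDelBarTerm H y x z w - delDelBarTerm H y z x w + delDelBarTerm H y w x z)
      + (delDelBarTerm H z x y w - delDelBarTerm H z y x w + delDelBarTerm H z w x y)
      - (delDelBarTerm H w x y z - delDelBarTerm H w y x z + delDelBarTerm H w z x y) := by
  have e1 : ∀ L : E →L[ℝ] E [⋀^Fin 3]→L[ℝ] ℂ, ∀ p, linearPartCLM E _ L p =
      (1 / 2 : ℂ) • (L p - Complex.I • L (Complex.I • p)) := fun _ _ => rfl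
  have e2 : ∀ L : E →L[ℝ] E [⋀^Fin 2]→L[ℝ] ℂ, ∀ p, antilinearPartCLM E _ L p =
      (1 / 2 : ℂ) • (L p + Complex.I • L (Complex.I • p)) := fun _ _ => rfl
  have ee : delDelBarCLM E H = ContinuousAlternatingMap.alternatizeUncurryFinCLM ℝ E ℂ
      (linearPartCLM E _ ((ContinuousAlternatingMap.alternatizeUncurryFinCLM ℝ E ℂ ∘L
        antilinearPartCLM E _) ∘L H)) := rfl
  have er0 : Fin.removeNth 0 ![x, y, z, w] = ![y, z, w] := by ext i; fin_cases i <;> rfl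
  have er1 : Fin.removeNth 1 ![x, y, z, w] = ![x, z, w] := by ext i; fin_cases i <;> rfl
  have er2 : Fin.removeNth 2 ![x, y, z, w] = ![x, y, w] := by ext i; fin_cases i <;> rfl
  have er3 : Fin.removeNth 3 ![x, y, z, w] = ![x, y, z] := by ext i; fin_cases i <;> rfl
  have es0 : ∀ x y z : E, Fin.removeNth 0 ![x, y, z] = ![y, z] := fun x y z => by
    ext i; fin_cases i <;> rfl
  have es1 : ∀ x y z : E, Fin.removeNth 1 ![x, y, z] = ![x, z] := fun x y z => by
    ext i; fin_cases i <;> rfl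
  have es2 : ∀ x y z : E, Fin.removeNth 2 ![x, y, z] = ![x, y] := fun x y z => by
    ext i; fin_cases i <;> rfl
  have a4 : ∀ L : E →L[ℝ] E [⋀^Fin 3]→L[ℝ] ℂ,
      ContinuousAlternatingMap.alternatizeUncurryFinCLM ℝ E ℂ L ![x, y, z, w] =
        L x ![y, z, w] - L y ![x, z, w] + L z ![x, y, w] - L w ![x, y, z] := by
    intro L
    rw [ContinuousAlternatingMap.alternatizeUncurryFinCLM_apply,
      ContinuousAlternatingMap.alternatizeUncurryFin_apply, Fin.sum_univ_four, er0, er1, er2, er3]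
    simp [pow_succ]
    ring
  have a3 : ∀ L : E →L[ℝ] E [⋀^Fin 2]→L[ℝ] ℂ, ∀ x y z : E,
      ContinuousAlternatingMap.alternatizeUncurryFinCLM ℝ E ℂ L ![x, y, z] =
        L x ![y, z] - L y ![x, z] + L z ![x, y] := by
    intro L x y z
    rw [ContinuousAlternatingMap.alternatizeUncurryFinCLM_apply,
      ContinuousAlternatingMap.alternatizeUncurryFin_apply, Fin.sum_univ_three, es0, es1, es2]
    simp [pow_succ]
    ring
  rw [ee, a4]
  simp only [e1, ContinuousAlternatingMap.smul_apply, ContinuousAlternatingMap.sub_apply,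
    ContinuousAlternatingMap.add_apply, ContinuousLinearMap.comp_apply, a3, e2, delDelBarTerm,
    smul_eq_mul]
  ring_nf
  simp only [Complex.I_sq]
  ring

/-- The algebraic core: the value at `(u, v, iu, iv)` of `∂∂̄` of a two-form whose second derivative
is that of `w ↦ b (A w ·, A w ·)` for an alternating form `b` of type `(1,1)` and a holomorphic `A`
with `A x = 1`. Here `a` and `c` stand for the first and second derivative of `A`. The result only
involves the torsion `a u v - a v u`. -/
theorem delDelBarCLM_apply_of_holomorphic {H : E →L[ℝ] E →L[ℝ] E [⋀^Fin 2]→L[ℝ] ℂ}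
    {b : E →L[ℝ] E →L[ℝ] ℂ} (hb : ∀ s t, b s t = -b t s)
    (hbI : ∀ s t, b (Complex.I • s) (Complex.I • t) = b s t)
    {a : E →L[ℂ] E →L[ℂ] E} {c : E →L[ℂ] E →L[ℂ] E →L[ℂ] E}
    (hH : ∀ p q s t, H p q ![s, t] = b (c p q s) t + b (a q s) (a p t) + b (a p s) (a q t) +
      b s (c p q t)) (u v : E) :
    delDelBarCLM E H ![u, v, Complex.I • u, Complex.I • v] =
      2 * Complex.I * b (a u v - a v u) (Complex.I • (a u v - a v u)) := by
  have hI : ∀ s : E, Complex.I • Complex.I • s = -s := fun s => by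
    rw [smul_smul, Complex.I_mul_I, neg_one_smul]
  have hb1 : ∀ s t, b (Complex.I • s) t = - b s (Complex.I • t) := fun s t => by
    have := hbI (Complex.I • s) t
    rw [hI] at this
    rw [← hbI, hI]; simp
  -- the terms with `c` cancel, because `c` is complex bilinear in the directions of derivation
  have key : ∀ p q s t, delDelBarTerm H p q s t =
      (1 / 2 : ℂ) * (b (a p s) (a q t) + b (a q s) (a p t) +
        Complex.I * (b (a p s) (Complex.I • a q t) - b (a q s) (Complex.I • a p t))) := by
    intro p q s t
    simp only [delDelBarTerm, hH, map_smul, smul_apply, hbI, hI, map_neg, neg_apply, hb1]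
    ring
  have hz : ∀ s, b s s = 0 := fun s => by
    have := hb s s
    exact self_eq_neg.1 this
  have h1 := hb (a v u) (a u v)
  have h2 : b (a v u) (Complex.I • a u v) = b (a u v) (Complex.I • a v u) := by
    rw [hb, hb1, neg_neg]
  have h3 : b (a v v) (Complex.I • a u u) = b (a u u) (Complex.I • a v v) := by
    rw [hb, hb1, neg_neg]
  rw [delDelBarCLM_apply]
  simp only [key, map_smul, smul_apply, hbI, hI, map_neg, smul_neg, hb1, hz, map_sub, smul_sub,
    sub_apply, h1, h2, h3]
  ring
end DelDelBar

/-! ### Smoothness of forms in finite dimension -/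

section FiniteDimensionalForms

/-- A map into a space of alternating forms in finite dimension is smooth as soon as all its
evaluations are. -/
theorem contDiffAt_of_forall_alternatingMap_apply {X E F : Type*} [NormedAddCommGroup X]
    [NormedSpace ℝ X] [NormedAddCommGroup E] [NormedSpace ℝ E] [FiniteDimensional ℝ E]
    [NormedAddCommGroup F] [NormedSpace ℝ F] [FiniteDimensional ℝ F] {ι : Type*} [Fintype ι]
    {n : WithTop ℕ∞} {f : X → E [⋀^ι]→L[ℝ] F} {x : X}
    (h : ∀ v, ContDiffAt ℝ n (fun y => f y v) x) : ContDiffAt ℝ n f x := by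
  classical
  let b := Module.finBasis ℝ E
  let L : E [⋀^ι]→L[ℝ] F →ₗ[ℝ] (ι → Fin (Module.finrank ℝ E)) → F :=
    { toFun := fun φ i => φ fun j => b (i j)
      map_add' := fun _ _ => rfl
      map_smul' := fun _ _ => rfl }
  have hL : LinearMap.ker L = ⊥ := by
    rw [LinearMap.ker_eq_bot]
    intro φ ψ hφψ
    apply ContinuousAlternatingMap.toAlternatingMap_injective
    exact Module.Basis.ext_alternating b fun i _ => congrFun hφψ i
  obtain ⟨g, hg⟩ := L.exists_leftInverse_of_injective hL
  have hf : f = fun y => LinearMap.toContinuousLinearMap g (L (f y)) := by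
    funext y
    exact (LinearMap.congr_fun hg (f y)).symm
  rw [hf]
  refine (ContinuousLinearMap.contDiff _).contDiffAt.comp x ?_
  exact contDiffAt_pi.2 fun i => h _

/-- A map into a space of linear maps from a finite-dimensional space is smooth as soon as all its
evaluations are. -/
theorem contDiffAt_clm_of_forall_apply {X E F : Type*} [NormedAddCommGroup X] [NormedSpace ℝ X]
    [NormedAddCommGroup E] [NormedSpace ℝ E] [FiniteDimensional ℝ E] [NormedAddCommGroup F]
    [NormedSpace ℝ F] {n : WithTop ℕ∞} {f : X → E →L[ℝ] F} {x : X}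
    (h : ∀ v, ContDiffAt ℝ n (fun y => f y v) x) : ContDiffAt ℝ n f x := by
  let e₁ := ContinuousLinearEquiv.ofFinrankEq
    (Module.finrank_fin_fun ℝ (n := Module.finrank ℝ E)).symm
  let e₂ := (e₁.arrowCongr (1 : F ≃L[ℝ] F)).trans
    (ContinuousLinearEquiv.piRing (Fin (Module.finrank ℝ E)))
  rw [← Function.id_comp f, ← e₂.symm_comp_self]
  exact e₂.symm.contDiff.contDiffAt.comp x (contDiffAt_pi.2 fun i => h _)

theorem continuousAlternatingMap_two_ext
    {E : Type*} [NormedAddCommGroup E] [NormedSpace ℝ E] {α β : E [⋀^Fin 2]→L[ℝ] ℂ}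
    (h : ∀ s t, α ![s, t] = β ![s, t]) : α = β := by
  ext v
  have hv : v = ![v 0, v 1] := by ext i; fin_cases i <;> rfl
  rw [hv]
  exact h _ _

end FiniteDimensionalForms

/-! ### Differentiation of integrals of smooth families over a compact space -/

section SmoothFamily

variable {E F M : Type*} [NormedAddCommGroup E] [NormedSpace ℝ E] [NormedAddCommGroup F]
  [NormedSpace ℝ F] [TopologicalSpace M]

/-- A family `a` of `F`-valued functions of a variable in `E`, parametrized by a space `M`, is a
`C^n` family near `x` if it is locally the pullback of a `C^n` function on `E × E` by a continuous
map in the parameter. -/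
def IsSmoothFamilyAt (n : ℕ) (a : E → M → F) (x : E) : Prop :=
  ∀ p₀ : M, ∃ (e : M → E) (f : E × E → F), (∀ᶠ p in 𝓝 p₀, ContinuousAt e p) ∧
    ContDiffAt ℝ n f (x, e p₀) ∧ ∀ᶠ z : E × M in 𝓝 (x, p₀), a z.1 z.2 = f (z.1, e z.2)

namespace IsSmoothFamilyAt

variable {n : ℕ} {a : E → M → F} {x : E}

theorem eventually_contDiffAt {e : M → E} {f : E × E → F} {p₀ : M}
    (he : ContinuousAt e p₀) (hf : ContDiffAt ℝ n f (x, e p₀)) :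
    ∀ᶠ z : E × M in 𝓝 (x, p₀), ContDiffAt ℝ n f (z.1, e z.2) := by
  have hc : ContinuousAt (fun z : E × M => (z.1, e z.2)) (x, p₀) :=
    continuousAt_fst.prodMk (ContinuousAt.comp (f := Prod.snd) he continuousAt_snd)
  exact hc.eventually (hf.eventually (by simp))

omit [NormedSpace ℝ E] in
theorem eventually_eventually_left {P : E × M → Prop} {x : E} {p₀ : M}
    (h : ∀ᶠ z in 𝓝 (x, p₀), P z) :
    ∀ᶠ z : E × M in 𝓝 (x, p₀), ∀ᶠ w in 𝓝 z.1, P (w, z.2) := by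
  filter_upwards [h.eventually_nhds] with z hz
  have hc : ContinuousAt (fun w => (w, z.2)) z.1 := by fun_prop
  exact hc.eventually hz

protected theorem fderiv (h : IsSmoothFamilyAt (n + 1) a x) :
    IsSmoothFamilyAt n (fun w p => fderiv ℝ (fun w => a w p) w) x := by
  intro p₀
  obtain ⟨e, f, he, hf, haf⟩ := h p₀
  refine ⟨e, fun z => fderiv ℝ f z ∘L ContinuousLinearMap.inl ℝ E E, he, ?_, ?_⟩
  · exact (hf.fderiv_right (m := n) (by norm_cast)).clm_comp contDiffAt_const
  · filter_upwards [eventually_eventually_left haf,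
      eventually_contDiffAt he.self_of_nhds hf] with z hz hfz
    have h1 : (fun w => a w z.2) =ᶠ[𝓝 z.1] fun w => f (w, e z.2) := hz
    rw [h1.fderiv_eq]
    exact ((hfz.differentiableAt (by simp)).hasFDerivAt.comp z.1
      (hasFDerivAt_prodMk_left z.1 (e z.2))).fderiv

theorem eventually_continuousAt (h : IsSmoothFamilyAt n a x) (p₀ : M) :
    ∀ᶠ z : E × M in 𝓝 (x, p₀), ContinuousAt (fun z : E × M => a z.1 z.2) z := by
  obtain ⟨e, f, he, hf, haf⟩ := h p₀
  have he' : ∀ᶠ z : E × M in 𝓝 (x, p₀), ContinuousAt e z.2 := continuousAt_snd.eventually he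
  filter_upwards [haf.eventually_nhds, eventually_contDiffAt he.self_of_nhds hf, he']
    with z hz hfz hez
  have hc : ContinuousAt (fun z : E × M => (z.1, e z.2)) z :=
    continuousAt_fst.prodMk (ContinuousAt.comp (f := Prod.snd) hez continuousAt_snd)
  have h1 : ContinuousAt (fun z : E × M => f (z.1, e z.2)) z :=
    ContinuousAt.comp (f := fun z : E × M => (z.1, e z.2)) hfz.continuousAt hc
  exact h1.congr (hz.mono fun y hy => hy.symm)

theorem eventually_hasFDerivAt (h : IsSmoothFamilyAt (n + 1) a x) (p₀ : M) :
    ∀ᶠ z : E × M in 𝓝 (x, p₀),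
      HasFDerivAt (fun w => a w z.2) (fderiv ℝ (fun w => a w z.2) z.1) z.1 := by
  obtain ⟨e, f, he, hf, haf⟩ := h p₀
  filter_upwards [eventually_eventually_left haf,
      eventually_contDiffAt he.self_of_nhds hf] with z hz hfz
  have h1 : (fun w => a w z.2) =ᶠ[𝓝 z.1] fun w => f (w, e z.2) := hz
  refine DifferentiableAt.hasFDerivAt (h1.differentiableAt_iff.2 ?_)
  exact ((hfz.differentiableAt (by simp)).hasFDerivAt.comp z.1
      (hasFDerivAt_prodMk_left z.1 (e z.2))).differentiableAt

variable [CompactSpace M]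

theorem eventually_continuous (h : IsSmoothFamilyAt n a x) :
    ∀ᶠ w in 𝓝 x, Continuous (a w) := by
  have := isCompact_univ.eventually_forall_of_forall_eventually (K := (Set.univ : Set M))
    (x₀ := x) (P := fun w p => ContinuousAt (fun z : E × M => a z.1 z.2) (w, p))
    fun p _ => h.eventually_continuousAt p
  filter_upwards [this] with w hw
  exact continuous_iff_continuousAt.2 fun p => ContinuousAt.comp (f := fun p => (w, p))
    (g := fun z : E × M => a z.1 z.2) (hw p trivial) (by fun_prop)

theorem exists_eventually_norm_le (h : IsSmoothFamilyAt n a x) :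
    ∃ C, ∀ᶠ w in 𝓝 x, ∀ p, ‖a w p‖ ≤ C := by
  obtain ⟨C, hC⟩ :=
    (isCompact_range h.eventually_continuous.self_of_nhds).isBounded.exists_norm_le
  refine ⟨C + 1, ?_⟩
  have := isCompact_univ.eventually_forall_of_forall_eventually (K := (Set.univ : Set M))
    (x₀ := x) (P := fun w p => ‖a w p‖ ≤ C + 1) fun p _ => by
      have h1 := (h.eventually_continuousAt p).self_of_nhds.norm
      have h2 : ‖a x p‖ < C + 1 := by linarith [hC (a x p) ⟨p, rfl⟩]
      exact (h1.eventually_lt continuousAt_const h2).mono fun z hz => hz.le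
  exact this.mono fun w hw p => hw p trivial

variable [MeasurableSpace M] [BorelSpace M] (m : MeasureTheory.Measure M)
  [MeasureTheory.IsFiniteMeasure m]

omit [MeasureTheory.IsFiniteMeasure m] in
theorem aestronglyMeasurable_of_continuous {F : Type*} [NormedAddCommGroup F] {g : M → F}
    (hg : Continuous g) : MeasureTheory.AEStronglyMeasurable g m :=
  (hg.stronglyMeasurable_of_hasCompactSupport
    (HasCompactSupport.of_compactSpace g)).aestronglyMeasurable

theorem eventually_hasFDerivAt_integral (h : IsSmoothFamilyAt (n + 1) a x) :
    ∀ᶠ w in 𝓝 x, HasFDerivAt (fun w => ∫ p, a w p ∂m)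
      (∫ p, fderiv ℝ (fun w => a w p) w ∂m) w := by
  obtain ⟨C, hC⟩ := h.fderiv.exists_eventually_norm_le
  have hd := isCompact_univ.eventually_forall_of_forall_eventually (K := (Set.univ : Set M))
    (x₀ := x) (P := fun w p => HasFDerivAt (fun w => a w p) (fderiv ℝ (fun w => a w p) w) w)
    fun p _ => h.eventually_hasFDerivAt p
  filter_upwards [h.eventually_continuous.eventually_nhds, h.fderiv.eventually_continuous,
    hC.eventually_nhds, hd.eventually_nhds] with w h1 h2 h3 h4
  refine hasFDerivAt_integral_of_dominated_of_fderiv_le (bound := fun _ => C) (h3.and h4)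
    (h1.mono fun w hw => aestronglyMeasurable_of_continuous m hw) ?_
    (aestronglyMeasurable_of_continuous m h2)
    (.of_forall fun p w hw => hw.1 p) (MeasureTheory.integrable_const C)
    (.of_forall fun p w hw => hw.2 p trivial)
  exact h1.self_of_nhds.integrable_of_hasCompactSupport (HasCompactSupport.of_compactSpace _)

/-- The second derivative of the integral of a `C²` family is the integral of the second
derivatives. -/
theorem fderiv_fderiv_integral (h : IsSmoothFamilyAt 2 a x) :
    fderiv ℝ (fderiv ℝ fun w => ∫ p, a w p ∂m) x =
      ∫ p, fderiv ℝ (fderiv ℝ fun w => a w p) x ∂m := by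
  have h1 : fderiv ℝ (fun w => ∫ p, a w p ∂m) =ᶠ[𝓝 x]
      fun w => ∫ p, fderiv ℝ (fun w => a w p) w ∂m :=
    (h.eventually_hasFDerivAt_integral m).mono fun w hw => hw.fderiv
  rw [h1.fderiv_eq]
  exact ((h.fderiv (n := 1)).eventually_hasFDerivAt_integral m).self_of_nhds.fderiv

omit [CompactSpace M] [MeasurableSpace M] [BorelSpace M] in
theorem contDiffAt (h : IsSmoothFamilyAt n a x) (p : M) : ContDiffAt ℝ n (fun w => a w p) x := by
  obtain ⟨e, f, he, hf, haf⟩ := h p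
  have h1 : (fun w => a w p) =ᶠ[𝓝 x] fun w => f (w, e p) :=
    (eventually_eventually_left haf).self_of_nhds
  refine ContDiffAt.congr_of_eventuallyEq ?_ h1
  exact ContDiffAt.comp x (g := f) (f := fun w => (w, e p)) hf
    (contDiffAt_id.prodMk contDiffAt_const)

end IsSmoothFamilyAt

end SmoothFamily

/-! ### `∂∂̄` of a `(1,1)`-form in a holomorphic frame -/

section HolomorphicFrame

/-- Evaluation of continuous alternating maps at a tuple of vectors, as a continuous linear map. -/
def alternatingEvalCLM {E : Type*} [NormedAddCommGroup E] [NormedSpace ℝ E] {ι : Type*} [Fintype ι]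
    (v : ι → E) : (E [⋀^ι]→L[ℝ] ℂ) →L[ℝ] ℂ :=
  ContinuousMultilinearMap.apply ℝ (fun _ => E) ℂ v ∘L
    ContinuousAlternatingMap.toContinuousMultilinearMapCLM ℝ

/-- A two-form as a bilinear map. -/
def alternatingTwoCurry {E : Type*} [NormedAddCommGroup E] [NormedSpace ℝ E]
    (B : E [⋀^Fin 2]→L[ℝ] ℂ) : E →L[ℝ] E →L[ℝ] ℂ :=
  (LinearMap.mk₂ ℝ (fun s t => B ![s, t])
    (fun s s' t => congrArg (fun φ => φ ![t]) (B.curryLeft.map_add s s'))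
    (fun c s t => congrArg (fun φ => φ ![t]) (B.curryLeft.map_smul c s))
    (fun s t t' => congrArg (fun φ => φ ![]) ((B.curryLeft s).curryLeft.map_add t t'))
    (fun c s t => congrArg (fun φ => φ ![]) ((B.curryLeft s).curryLeft.map_smul c t))
    ).mkContinuous₂ ‖B‖ fun s t => by
      have := B.le_opNorm ![s, t]
      rw [Fin.prod_univ_two, ← mul_assoc] at this
      exact this

variable {E : Type*} [NormedAddCommGroup E] [NormedSpace ℂ E] [FiniteDimensional ℂ E]

theorem alternatingTwoCurry_apply {E : Type*} [NormedAddCommGroup E] [NormedSpace ℝ E]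
    (B : E [⋀^Fin 2]→L[ℝ] ℂ) (s t : E) : alternatingTwoCurry B s t = B ![s, t] := rfl

theorem contDiffAt_of_eventually_apply_eq {α : E → E [⋀^Fin 2]→L[ℝ] ℂ} {B : E [⋀^Fin 2]→L[ℝ] ℂ}
    {A : E → E →L[ℂ] E} {x : E} (hA : ContDiffAt ℂ 2 A x)
    (hα : ∀ᶠ w in 𝓝 x, ∀ s t, α w ![s, t] = B ![A w s, A w t]) : ContDiffAt ℝ 2 α x := by
  have : FiniteDimensional ℝ E := FiniteDimensional.complexToReal E
  have hAr (s : E) : ContDiffAt ℝ 2 (fun w => A w s) x :=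
    (hA.clm_apply contDiffAt_const).restrict_scalars ℝ
  refine contDiffAt_of_forall_alternatingMap_apply fun v => ?_
  have hv : v = ![v 0, v 1] := by ext i; fin_cases i <;> rfl
  rw [hv]
  refine ContDiffAt.congr_of_eventuallyEq ?_ (hα.mono fun w hw => hw _ _)
  exact ((contDiffAt_const (c := alternatingTwoCurry B)).clm_apply (hAr _)).clm_apply (hAr _)

/-- The value of `∂∂̄` at `(u, v, iu, iv)` for a form `w ↦ B (A w ·, A w ·)`, where `B` is a
`(1,1)`-form with constant coefficients and `A` is holomorphic: it is `2i B (T, iT)`, where `T` is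
the torsion `A' u v - A' v u`. -/
theorem formDel_formDelBar_of_holomorphic {α : E → E [⋀^Fin 2]→L[ℝ] ℂ} {B : E [⋀^Fin 2]→L[ℝ] ℂ}
    {A : E → E →L[ℂ] E} {x : E} (hA : ContDiffAt ℂ 2 A x) (hAx : A x = .id ℂ E)
    (hB : ∀ s t, B ![Complex.I • s, Complex.I • t] = B ![s, t])
    (hα : ∀ᶠ w in 𝓝 x, ∀ s t, α w ![s, t] = B ![A w s, A w t]) (u v : E) :
    formDel (formDelBar α) x ![u, v, Complex.I • u, Complex.I • v] =
      2 * Complex.I * B ![fderiv ℂ A x u v - fderiv ℂ A x v u,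
        Complex.I • (fderiv ℂ A x u v - fderiv ℂ A x v u)] := by
  let b : E →L[ℝ] E →L[ℝ] ℂ := alternatingTwoCurry B
  have hA' (s : E) : ContDiffAt ℂ 2 (fun w => A w s) x := hA.clm_apply contDiffAt_const
  have hAr (s : E) : ContDiffAt ℝ 2 (fun w => A w s) x := (hA' s).restrict_scalars ℝ
  have hαs (s t : E) : (fun w => α w ![s, t]) =ᶠ[𝓝 x] fun w => b (A w s) (A w t) :=
    hα.mono fun w hw => hw s t
  have hα2 : ContDiffAt ℝ 2 α x := contDiffAt_of_eventually_apply_eq hA hα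
  rw [formDel_formDelBar_eq hα2]
  have hH (p q s t : E) : fderiv ℝ (fderiv ℝ α) x p q ![s, t] =
      b (fderiv ℂ (fderiv ℂ A) x p q s) t + b (fderiv ℂ A x q s) (fderiv ℂ A x p t) +
      b (fderiv ℂ A x p s) (fderiv ℂ A x q t) + b s (fderiv ℂ (fderiv ℂ A) x p q t) := by
    have h0 := fderiv_fderiv_clm_comp
      (alternatingEvalCLM ![s, t]) hα2 p q
    have hdA : HasFDerivAt A (fderiv ℂ A x) x :=
      (hA.differentiableAt (by norm_num)).hasFDerivAt
    have hdA' : HasFDerivAt (fderiv ℂ A) (fderiv ℂ (fderiv ℂ A) x) x :=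
      ((hA.fderiv_right (m := 1) (by norm_num)).differentiableAt (by norm_num)).hasFDerivAt
    have h1 (s q : E) : fderiv ℝ (fun w => A w s) x q = fderiv ℂ A x q s := by
      rw [(fderiv_restrictScalars_eventuallyEq (hA' s)).self_of_nhds]
      beta_reduce
      rw [(hdA.clm_apply (hasFDerivAt_const s x)).fderiv]
      simp
    have h2 (s p q : E) : fderiv ℝ (fderiv ℝ fun w => A w s) x p q =
        fderiv ℂ (fderiv ℂ A) x p q s := by
      have hs : fderiv ℂ (fun w => A w s) =ᶠ[𝓝 x] fun w => (fderiv ℂ A w).flip s := by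
        filter_upwards [hA.eventually (by simp)] with w hw
        rw [((hw.differentiableAt (by norm_num)).hasFDerivAt.clm_apply
          (hasFDerivAt_const s w)).fderiv]
        simp
      rw [fderiv_fderiv_restrictScalars (hA' s), hs.fderiv_eq]
      have h5 : HasFDerivAt (fun w => (fderiv ℂ A w).flip s) _ x :=
        ((ContinuousLinearMap.apply ℂ (E →L[ℂ] E) s ∘L
          (ContinuousLinearMap.flipₗᵢ ℂ E E E).toContinuousLinearEquiv.toContinuousLinearMap
          ).hasFDerivAt).comp x hdA'
      rw [h5.fderiv]
      rfl
    have h3 := fderiv_fderiv_bilinear b (hAr s) (hAr t) p q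
    rw [← (hαs s t).fderiv.fderiv_eq] at h3
    rw [h2, h2, h1, h1, h1, h1, hAx] at h3
    exact h0.symm.trans h3
  refine delDelBarCLM_apply_of_holomorphic (b := b) (fun s t => ?_) hB hH u v
  have hst : ![s, t] = ![t, s] ∘ Equiv.swap 0 1 := by ext i; fin_cases i <;> rfl
  rw [alternatingTwoCurry_apply, alternatingTwoCurry_apply, hst]
  exact B.map_swap ![t, s] (by decide)

end HolomorphicFrame

/-! ### The invariant measure on a compact quotient -/

section InvariantMeasure

open MeasureTheory Measure

variable {G : Type*} [Group G] [TopologicalSpace G] [IsTopologicalGroup G]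

omit [TopologicalSpace G] [IsTopologicalGroup G] in
theorem isFundamentalDomain_op_of_injOn_mk [MeasurableSpace G] {Γ : Subgroup G} {F : Set G}
    {ν : Measure G}
    (hF : MeasurableSet F) (hinj : Set.InjOn (QuotientGroup.mk : G → G ⧸ Γ) F)
    (hsurj : (QuotientGroup.mk : G → G ⧸ Γ) '' F = Set.univ) : IsFundamentalDomain Γ.op F ν := by
  refine IsFundamentalDomain.mk' hF.nullMeasurableSet fun x => ?_
  obtain ⟨y, hy, hyx⟩ : (QuotientGroup.mk x : G ⧸ Γ) ∈ QuotientGroup.mk '' F := hsurj ▸ trivial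
  refine ⟨⟨MulOpposite.op (x⁻¹ * y), ?_⟩, ?_, ?_⟩
  · exact QuotientGroup.eq.1 hyx.symm
  · simpa [Subgroup.smul_def] using hy
  · rintro ⟨γ, hγ⟩ h
    have h' : x * γ.unop ∈ F := h
    have h1 : x * γ.unop = y := hinj h' hy (by
      rw [hyx]; exact QuotientGroup.mk_mul_of_mem _ hγ)
    ext
    simp [← h1]

/-- A compact quotient by a discrete subgroup has a relatively compact Borel fundamental domain. -/
theorem exists_measurableSet_injOn_mk [LocallyCompactSpace G] [MeasurableSpace G] [BorelSpace G]
    (Γ : Subgroup G) [DiscreteTopology Γ] [CompactSpace (G ⧸ Γ)] :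
    ∃ F K : Set G, MeasurableSet F ∧ IsCompact K ∧ F ⊆ K ∧
      Set.InjOn (QuotientGroup.mk : G → G ⧸ Γ) F ∧
      (QuotientGroup.mk : G → G ⧸ Γ) '' F = Set.univ := by
  classical
  have hπ := isLocalHomeomorph_quotientGroup_mk Γ
  have hU (a : G) : ∃ U K : Set G, IsOpen U ∧ a ∈ U ∧ IsCompact K ∧ U ⊆ K ∧
      Set.InjOn (QuotientGroup.mk : G → G ⧸ Γ) U := by
    obtain ⟨K, hK, haK⟩ := exists_compact_mem_nhds a
    refine ⟨interior K ∩ (hπ.localInverseAt a).target, K,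
      isOpen_interior.inter (hπ.localInverseAt a).open_target,
      ⟨mem_interior_iff_mem_nhds.2 haK, hπ.self_mem_localInverseAt_target⟩, hK,
      Set.inter_subset_left.trans interior_subset, ?_⟩
    exact hπ.injOn_localInverseAt_target.mono Set.inter_subset_right
  choose U K hUo haU hK hUK hUinj using hU
  have hπU (a : G) : IsOpen ((QuotientGroup.mk : G → G ⧸ Γ) '' U a) :=
    hπ.isOpenMap _ (hUo a)
  -- add the sets `U a` one after the other, leaving out the classes already met
  have step (t : Finset G) : ∃ F : Set G, MeasurableSet F ∧ F ⊆ ⋃ a ∈ t, K a ∧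
      Set.InjOn (QuotientGroup.mk : G → G ⧸ Γ) F ∧
      (QuotientGroup.mk : G → G ⧸ Γ) '' F = ⋃ a ∈ t, QuotientGroup.mk '' U a := by
    induction t using Finset.induction_on with
    | empty => exact ⟨∅, by simp⟩
    | insert a t _ ih =>
      obtain ⟨F, hF, hFK, hinj, himg⟩ := ih
      have hopen : IsOpen ((QuotientGroup.mk : G → G ⧸ Γ) '' F) := by
        rw [himg]; exact isOpen_biUnion fun a _ => hπU a
      refine ⟨F ∪ (U a \ QuotientGroup.mk ⁻¹' ((QuotientGroup.mk : G → G ⧸ Γ) '' F)), ?_, ?_, ?_,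
        ?_⟩
      · exact hF.union ((hUo a).measurableSet.diff
          (hopen.preimage QuotientGroup.continuous_mk).measurableSet)
      · rw [Finset.set_biUnion_insert]
        exact Set.union_subset (hFK.trans Set.subset_union_right)
          ((Set.sdiff_subset.trans (hUK a)).trans Set.subset_union_left)
      · rintro x (hx | hx) y (hy | hy) hxy
        · exact hinj hx hy hxy
        · exact absurd ⟨x, hx, hxy⟩ hy.2
        · exact absurd ⟨y, hy, hxy.symm⟩ hx.2
        · exact hUinj a hx.1 hy.1 hxy
      · rw [Finset.set_biUnion_insert, ← himg, Set.image_union]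
        ext q
        constructor
        · rintro (h | ⟨x, hx, rfl⟩)
          · exact Or.inr h
          · exact Or.inl ⟨x, hx.1, rfl⟩
        · rintro (⟨x, hx, rfl⟩ | h)
          · by_cases hq : (QuotientGroup.mk x : G ⧸ Γ) ∈ QuotientGroup.mk '' F
            · exact Or.inl hq
            · exact Or.inr ⟨x, ⟨hx, hq⟩, rfl⟩
          · exact Or.inl h
  obtain ⟨t, ht⟩ := isCompact_univ.elim_finite_subcover
    (fun a => (QuotientGroup.mk : G → G ⧸ Γ) '' U a) hπU fun q _ => by
      obtain ⟨a, rfl⟩ := QuotientGroup.mk_surjective q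
      exact Set.mem_iUnion.2 ⟨a, a, haU a, rfl⟩
  obtain ⟨F, hF, hFK, hinj, himg⟩ := step t
  exact ⟨F, _, hF, t.isCompact_biUnion fun a _ => hK a, hFK, hinj, himg.trans
    (Set.univ_subset_iff.1 ht)⟩

/-- A compact quotient `G ⧸ Γ` by a discrete subgroup carries a nonzero finite `G`-invariant Borel
measure. It is induced by a right Haar measure on a fundamental domain; left translations multiply
it by a constant, which must be `1` because the total mass is finite. -/
theorem exists_finite_smulInvariant_measure [LocallyCompactSpace G] [SecondCountableTopology G]
    (Γ : Subgroup G) [DiscreteTopology Γ] [CompactSpace (G ⧸ Γ)]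
    [MeasurableSpace (G ⧸ Γ)] [BorelSpace (G ⧸ Γ)] :
    ∃ m : Measure (G ⧸ Γ), IsFiniteMeasure m ∧ m ≠ 0 ∧ ∀ g : G, m.map (g • ·) = m := by
  borelize G
  have hcount : Countable Γ := TopologicalSpace.separableSpace_iff_countable.1 inferInstance
  have hcount' : Countable Γ.op := Countable.of_equiv Γ Γ.equivOp
  obtain ⟨F, K, hF, hK, hFK, hinj, hsurj⟩ := exists_measurableSet_injOn_mk Γ
  let μ : Measure G := haar
  let ν : Measure G := μ.inv
  have hfd : IsFundamentalDomain Γ.op F ν := isFundamentalDomain_op_of_injOn_mk hF hinj hsurj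
  have hπ : Measurable (QuotientGroup.mk : G → G ⧸ Γ) := QuotientGroup.continuous_mk.measurable
  have hνF : ν F < ⊤ := by
    refine (measure_mono hFK).trans_lt ?_
    rw [Measure.inv_apply]
    exact hK.inv.measure_lt_top
  have hν0 : ν ≠ 0 := by
    intro h
    have : ν Set.univ = 0 := by rw [h]; simp
    rw [Measure.inv_apply, Set.inv_univ] at this
    exact NeZero.ne μ (Measure.measure_univ_eq_zero.1 this)
  let m : Measure (G ⧸ Γ) := (ν.restrict F).map QuotientGroup.mk
  have hm (A : Set (G ⧸ Γ)) (hA : MeasurableSet A) : m A = ν (QuotientGroup.mk ⁻¹' A ∩ F) := by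
    rw [Measure.map_apply hπ hA, Measure.restrict_apply (hπ hA)]
  have hmu : m Set.univ = ν F := by simp [hm _ MeasurableSet.univ]
  have hmfin : IsFiniteMeasure m := ⟨hmu ▸ hνF⟩
  have hνF0 : ν F ≠ 0 := hfd.measure_ne_zero hν0
  refine ⟨m, hmfin, fun h => hνF0 (by rw [← hmu, h]; simp), fun g => ?_⟩
  -- `ν` is right invariant, so left translation by `g` multiplies it by a constant
  obtain ⟨c, hc⟩ : ∃ c : NNReal, ν.map (g * ·) = c • ν := by
    obtain ⟨c, h1⟩ : ∃ c : NNReal, μ.map (· * g⁻¹) = c • μ :=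
      ⟨_, isMulLeftInvariant_eq_smul (μ.map (· * g⁻¹)) μ⟩
    refine ⟨c, ?_⟩
    have h2 : ν.map (g * ·) = (μ.map (· * g⁻¹)).map Inv.inv := by
      change (μ.map Inv.inv).map (g * ·) = _
      rw [Measure.map_map (measurable_const_mul g) measurable_inv,
        Measure.map_map measurable_inv (measurable_mul_const _)]
      congr 1
      ext x
      simp
    rw [h2, h1, Measure.map_smul]
    rfl
  have hgF : MeasurableSet ((g⁻¹ * ·) ⁻¹' F) := measurable_const_mul _ hF
  have hfd' : IsFundamentalDomain Γ.op ((g⁻¹ * ·) ⁻¹' F) ν := by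
    refine isFundamentalDomain_op_of_injOn_mk hgF ?_ ?_
    · intro x hx y hy hxy
      have : g⁻¹ * x = g⁻¹ * y := hinj hx hy (congrArg (fun q : G ⧸ Γ => g⁻¹ • q) hxy)
      exact mul_left_cancel this
    · refine Set.eq_univ_of_forall fun q => ?_
      obtain ⟨x, hx, hxq⟩ : g⁻¹ • q ∈ (QuotientGroup.mk : G → G ⧸ Γ) '' F := hsurj ▸ trivial
      refine ⟨g * x, by simpa using hx, ?_⟩
      have : (QuotientGroup.mk (g * x) : G ⧸ Γ) = g • QuotientGroup.mk x := rfl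
      rw [this, hxq, smul_inv_smul]
  have hscale (A : Set (G ⧸ Γ)) (hA : MeasurableSet A) : m.map (g • ·) A = c * m A := by
    have hA' : MeasurableSet ((fun q : G ⧸ Γ => g • q) ⁻¹' A) := measurable_const_smul g hA
    rw [Measure.map_apply (measurable_const_smul g) hA, hm _ hA', hm _ hA]
    have h1 : (QuotientGroup.mk : G → G ⧸ Γ) ⁻¹' ((fun q : G ⧸ Γ => g • q) ⁻¹' A) ∩ F =
        (g * ·) ⁻¹' (QuotientGroup.mk ⁻¹' A ∩ (g⁻¹ * ·) ⁻¹' F) := by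
      ext x
      simp
    rw [h1, ← Measure.map_apply (measurable_const_mul g) ((hπ hA).inter hgF), hc,
      Measure.smul_apply, ENNReal.smul_def, smul_eq_mul]
    congr 1
    refine hfd'.measure_set_eq hfd (hπ hA) fun γ => ?_
    ext x
    have : (QuotientGroup.mk (γ • x) : G ⧸ Γ) = QuotientGroup.mk x :=
      QuotientGroup.mk_mul_of_mem _ γ.2
    simp [this]
  have hc1 : (c : ENNReal) = 1 := by
    have h1 := hscale Set.univ MeasurableSet.univ
    rw [Measure.map_apply (measurable_const_smul g) MeasurableSet.univ, Set.preimage_univ, hmu]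
      at h1
    exact ((ENNReal.mul_eq_right hνF0 hνF.ne).1 h1.symm)
  ext A hA
  rw [hscale A hA, hc1, one_mul]

end InvariantMeasure

/-! ### Local group laws with vanishing bracket -/

section LocalGroup

variable {E : Type*} [NormedAddCommGroup E] [NormedSpace ℂ E]

/-- The derivative of a function of two variables in the first variable. -/
def fderivLeft (f : E × E → E) (z : E × E) : E →L[ℂ] E :=
  fderiv ℂ f z ∘L ContinuousLinearMap.inl ℂ E E

/-- The derivative of a function of two variables in the second variable. -/
def fderivRight (f : E × E → E) (z : E × E) : E →L[ℂ] E :=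
  fderiv ℂ f z ∘L ContinuousLinearMap.inr ℂ E E

theorem hasFDerivAt_fderivLeft {f : E × E → E} {z : E × E} (hf : DifferentiableAt ℂ f z) :
    HasFDerivAt (fun x => f (x, z.2)) (fderivLeft f z) z.1 :=
  HasFDerivAt.comp (g := f) z.1 hf.hasFDerivAt (hasFDerivAt_prodMk_left z.1 z.2)

theorem hasFDerivAt_fderivRight {f : E × E → E} {z : E × E} (hf : DifferentiableAt ℂ f z) :
    HasFDerivAt (fun y => f (z.1, y)) (fderivRight f z) z.2 :=
  HasFDerivAt.comp (g := f) z.2 hf.hasFDerivAt (hasFDerivAt_prodMk_right z.1 z.2)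

theorem ContDiffAt.fderivLeft {f : E × E → E} {z : E × E} {n : WithTop ℕ∞}
    (hf : ContDiffAt ℂ (n + 1) f z) : ContDiffAt ℂ n (fderivLeft f) z :=
  (hf.fderiv_right le_rfl).clm_comp contDiffAt_const

theorem ContDiffAt.fderivRight {f : E × E → E} {z : E × E} {n : WithTop ℕ∞}
    (hf : ContDiffAt ℂ (n + 1) f z) : ContDiffAt ℂ n (fderivRight f) z :=
  (hf.fderiv_right le_rfl).clm_comp contDiffAt_const

theorem Filter.Eventually.curry_nhds_right {X Y : Type*} [TopologicalSpace X] [TopologicalSpace Y]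
    {P : X × Y → Prop} {x : X} {y : Y} (h : ∀ᶠ z in 𝓝 (x, y), P z) :
    ∀ᶠ y' in 𝓝 y, ∀ᶠ x' in 𝓝 x, P (x', y') := by
  have hc : ContinuousAt (Prod.swap : Y × X → X × Y) (y, x) := continuous_swap.continuousAt
  exact (hc.eventually h).curry_nhds

theorem fderiv_fderivLeft_comp {f : E × E → E} {x : E} (hf : ContDiffAt ℂ 2 f (x, x)) (u v : E) :
    fderiv ℂ (fun w => fderivLeft f (x, w)) x u v = fderiv ℂ (fderiv ℂ f) (x, x) (0, u) (v, 0) := by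
  have hd : HasFDerivAt (fderiv ℂ f) (fderiv ℂ (fderiv ℂ f) (x, x)) (x, x) :=
    ((hf.fderiv_right (m := 1) (by norm_num)).differentiableAt (by norm_num)).hasFDerivAt
  have h1 : HasFDerivAt (fun w => fderiv ℂ f (x, w)) _ x :=
    HasFDerivAt.comp (g := fderiv ℂ f) x hd (hasFDerivAt_prodMk_right x x)
  have h2 : HasFDerivAt (fun w => fderivLeft f (x, w)) _ x :=
    h1.clm_comp (hasFDerivAt_const (ContinuousLinearMap.inl ℂ E E) x)
  rw [h2.fderiv]
  simp

theorem fderiv_fderivRight_comp {f : E × E → E} {x : E} (hf : ContDiffAt ℂ 2 f (x, x)) (u v : E) :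
    fderiv ℂ (fun w => fderivRight f (w, x)) x u v =
      fderiv ℂ (fderiv ℂ f) (x, x) (u, 0) (0, v) := by
  have hd : HasFDerivAt (fderiv ℂ f) (fderiv ℂ (fderiv ℂ f) (x, x)) (x, x) :=
    ((hf.fderiv_right (m := 1) (by norm_num)).differentiableAt (by norm_num)).hasFDerivAt
  have h1 : HasFDerivAt (fun w => fderiv ℂ f (w, x)) _ x :=
    HasFDerivAt.comp (g := fderiv ℂ f) x hd (hasFDerivAt_prodMk_left x x)
  have h2 : HasFDerivAt (fun w => fderivRight f (w, x)) _ x :=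
    h1.clm_comp (hasFDerivAt_const (ContinuousLinearMap.inr ℂ E E) x)
  rw [h2.fderiv]
  simp

/-- A holomorphic local group law `mul` with neutral element `o`, together with its conjugation
`conj (x, y) = x y x⁻¹`. Both maps are only constrained near `o`. Conjugation replaces inversion and
associativity: it is characterized by `(x y x⁻¹) x = x y`, and it is a local action of `mul`. -/
structure IsLocalGroupLaw (o : E) (mul conj : E × E → E) : Prop where
  contDiffAt_mul : ContDiffAt ℂ 2 mul (o, o)
  contDiffAt_conj : ContDiffAt ℂ 2 conj (o, o)
  one_mul : ∀ᶠ v in 𝓝 o, mul (o, v) = v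
  mul_one : ∀ᶠ v in 𝓝 o, mul (v, o) = v
  one_conj : ∀ᶠ v in 𝓝 o, conj (o, v) = v
  conj_one : ∀ᶠ v in 𝓝 o, conj (v, o) = o
  conj_mul : ∀ᶠ z : E × E in 𝓝 (o, o), mul (conj z, z.1) = mul z
  mul_conj : ∀ᶠ z : E × E × E in 𝓝 (o, o, o),
    conj (mul (z.1, z.2.1), z.2.2) = conj (z.1, conj (z.2.1, z.2.2))

namespace IsLocalGroupLaw

variable {o : E} {mul conj : E × E → E}

theorem eventually_differentiableAt {f : E × E → E} (hf : ContDiffAt ℂ 2 f (o, o)) :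
    ∀ᶠ z in 𝓝 (o, o), DifferentiableAt ℂ f z :=
  (hf.eventually (by simp)).mono fun _ hz => hz.differentiableAt (by norm_num)

theorem fderivLeft_mul_one (h : IsLocalGroupLaw o mul conj) :
    ∀ᶠ x in 𝓝 o, fderivLeft mul (x, o) = .id ℂ E := by
  filter_upwards [h.mul_one.eventually_nhds,
    (eventually_differentiableAt h.contDiffAt_mul).curry_nhds] with x hx hd
  have h1 := hasFDerivAt_fderivLeft hd.self_of_nhds
  exact h1.unique ((hasFDerivAt_id x).congr_of_eventuallyEq hx)

/-- The derivative at `o` of right translation by `x` is invertible for `x` near `o`. -/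
theorem isInvertible_fderivLeft_mul [CompleteSpace E] (h : IsLocalGroupLaw o mul conj) :
    ∀ᶠ x in 𝓝 o, IsUnit (fderivLeft mul (o, x)) := by
  have hc : ContinuousAt (fun x => fderivLeft mul (o, x)) o :=
    ContinuousAt.comp (g := fderivLeft mul) (f := fun x => (o, x))
      (h.contDiffAt_mul.fderivLeft (n := 1)).continuousAt (by fun_prop)
  refine hc.eventually (Units.isOpen.mem_nhds ?_)
  change IsUnit (fderivLeft mul (o, o))
  rw [h.fderivLeft_mul_one.self_of_nhds]
  exact isUnit_one

/-- `R Ad = L`, where `R` and `L` are the derivatives at `o` of the right and left translations by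
`x`, and `Ad` is the derivative at `o` of conjugation by `x`. -/
theorem fderivLeft_mul_comp_fderivRight_conj (h : IsLocalGroupLaw o mul conj) :
    ∀ᶠ x in 𝓝 o, fderivLeft mul (o, x) ∘L fderivRight conj (x, o) = fderivRight mul (x, o) := by
  filter_upwards [h.conj_mul.curry_nhds, h.conj_one,
    (eventually_differentiableAt h.contDiffAt_mul).curry_nhds,
    (eventually_differentiableAt h.contDiffAt_mul).curry_nhds_right,
    (eventually_differentiableAt h.contDiffAt_conj).curry_nhds] with x hx hx1 hd hd' hdc
  have h1 := hasFDerivAt_fderivRight hd.self_of_nhds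
  have h2 := hasFDerivAt_fderivRight hdc.self_of_nhds
  have h3 : HasFDerivAt (fun x' => mul (x', x)) (fderivLeft mul (o, x)) (conj (x, o)) := by
    rw [hx1]; exact hasFDerivAt_fderivLeft hd'.self_of_nhds
  exact (HasFDerivAt.comp (g := fun x' => mul (x', x)) o h3 h2).unique
    (h1.congr_of_eventuallyEq hx)

theorem fderivRight_conj_one (h : IsLocalGroupLaw o mul conj) :
    fderivRight conj (o, o) = .id ℂ E := by
  have h1 := hasFDerivAt_fderivRight (z := (o, o))
    (eventually_differentiableAt h.contDiffAt_conj).self_of_nhds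
  exact h1.unique ((hasFDerivAt_id o).congr_of_eventuallyEq h.one_conj)

theorem hasFDerivAt_fderivRight_conj (h : IsLocalGroupLaw o mul conj) :
    ∀ᶠ x in 𝓝 o, HasFDerivAt (fun x => fderivRight conj (x, o))
      (fderiv ℂ (fun x => fderivRight conj (x, o)) x) x := by
  have hc : ContDiffAt ℂ 1 (fun x => fderivRight conj (x, o)) o :=
    ContDiffAt.comp (g := fderivRight conj) (f := fun x => (x, o)) o
      (h.contDiffAt_conj.fderivRight (n := 1)) (contDiffAt_id.prodMk contDiffAt_const)
  filter_upwards [hc.eventually (by simp)] with x hx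
  exact (hx.differentiableAt (by norm_num)).hasFDerivAt

theorem contDiffAt_fderivLeft_mul (h : IsLocalGroupLaw o mul conj) :
    ContDiffAt ℂ 1 (fun x => fderivLeft mul (o, x)) o :=
  ContDiffAt.comp (g := fderivLeft mul) (f := fun x => (o, x)) o
    (h.contDiffAt_mul.fderivLeft (n := 1)) (contDiffAt_const.prodMk contDiffAt_id)

/-- If the bracket, i.e. the antisymmetric part of the second order term of the group law,
vanishes, then the derivative of the adjoint representation at the neutral element vanishes. -/
theorem fderiv_fderivRight_conj_eq_zero (h : IsLocalGroupLaw o mul conj)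
    (hsymm : ∀ u v, fderiv ℂ (fun x => fderivLeft mul (o, x)) o u v =
      fderiv ℂ (fun x => fderivLeft mul (o, x)) o v u) :
    fderiv ℂ (fun x => fderivRight conj (x, o)) o = 0 := by
  have hR := (h.contDiffAt_fderivLeft_mul.differentiableAt (by norm_num)).hasFDerivAt
  have h1 := (hR.clm_comp h.hasFDerivAt_fderivRight_conj.self_of_nhds).congr_of_eventuallyEq
    (h.fderivLeft_mul_comp_fderivRight_conj.mono fun x hx => hx.symm)
  have hs : IsSymmSndFDerivAt ℂ mul (o, o) :=
    h.contDiffAt_mul.isSymmSndFDerivAt (by simp)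
  ext u v
  have h2 := congrArg (fun L => L u v) h1.fderiv
  simp only [fderiv_fderivRight_comp h.contDiffAt_mul, h.fderivRight_conj_one,
    h.fderivLeft_mul_one.self_of_nhds] at h2
  rw [hs.eq, ← fderiv_fderivLeft_comp h.contDiffAt_mul, hsymm] at h2
  simpa using h2

theorem tendsto_mul (h : IsLocalGroupLaw o mul conj) :
    Filter.Tendsto mul (𝓝 (o, o)) (𝓝 o) := by
  have := h.contDiffAt_mul.continuousAt.tendsto
  rwa [h.one_mul.self_of_nhds] at this

theorem tendsto_conj (h : IsLocalGroupLaw o mul conj) :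
    Filter.Tendsto conj (𝓝 (o, o)) (𝓝 o) := by
  have := h.contDiffAt_conj.continuousAt.tendsto
  rwa [h.one_conj.self_of_nhds] at this

/-- The adjoint representation `x ↦ D (y ↦ x y x⁻¹)` is multiplicative. -/
theorem fderivRight_conj_mul (h : IsLocalGroupLaw o mul conj) :
    ∀ᶠ z : E × E in 𝓝 (o, o), fderivRight conj (mul z, o) =
      fderivRight conj (z.1, o) ∘L fderivRight conj (z.2, o) := by
  have hd := (eventually_differentiableAt h.contDiffAt_conj).curry_nhds
  have h4 : ∀ᶠ z : (E × E) × E in 𝓝 ((o, o), o),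
      conj (mul (z.1.1, z.1.2), z.2) = conj (z.1.1, conj (z.1.2, z.2)) := by
    have hc : ContinuousAt (fun z : (E × E) × E => (z.1.1, z.1.2, z.2)) ((o, o), o) := by fun_prop
    exact hc.eventually h.mul_conj
  filter_upwards [h4.curry_nhds, h.tendsto_mul.eventually hd,
    (continuousAt_fst (p := (o, o))).eventually hd,
    (continuousAt_snd (p := (o, o))).eventually hd,
    (continuousAt_snd (p := (o, o))).eventually h.conj_one] with z hz hd1 hd2 hd3 ho
  have h1 := hasFDerivAt_fderivRight hd1.self_of_nhds
  have h2 := hasFDerivAt_fderivRight hd3.self_of_nhds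
  have h3 : HasFDerivAt (fun y => conj (z.1, y)) (fderivRight conj (z.1, o)) (conj (z.2, o)) := by
    rw [ho]; exact hasFDerivAt_fderivRight hd2.self_of_nhds
  exact h1.unique
    ((HasFDerivAt.comp (g := fun y => conj (z.1, y)) o h3 h2).congr_of_eventuallyEq hz)

/-- If the bracket vanishes, then the adjoint representation is trivial near the neutral
element. -/
theorem fderivRight_conj_eq_id [CompleteSpace E] (h : IsLocalGroupLaw o mul conj)
    (hsymm : ∀ u v, fderiv ℂ (fun x => fderivLeft mul (o, x)) o u v =
      fderiv ℂ (fun x => fderivLeft mul (o, x)) o v u) :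
    ∀ᶠ x in 𝓝 o, fderivRight conj (x, o) = .id ℂ E := by
  have hdc := h.hasFDerivAt_fderivRight_conj
  -- differentiate `Ad (y x) = Ad y ∘ Ad x` in `y` at the neutral element
  have hzero : ∀ᶠ x in 𝓝 o, fderiv ℂ (fun x => fderivRight conj (x, o)) x = 0 := by
    filter_upwards [h.fderivRight_conj_mul.curry_nhds_right, h.one_mul, hdc,
      (eventually_differentiableAt h.contDiffAt_mul).curry_nhds_right,
      h.isInvertible_fderivLeft_mul] with x hx hx1 hdx hd hu
    have h1 : HasFDerivAt (fun x => fderivRight conj (x, o))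
        (fderiv ℂ (fun x => fderivRight conj (x, o)) x) (mul (o, x)) := by rw [hx1]; exact hdx
    have h2 := HasFDerivAt.comp (g := fun x => fderivRight conj (x, o)) o h1
      (hasFDerivAt_fderivLeft hd.self_of_nhds)
    have h3 := (hdc.self_of_nhds.clm_comp
      (hasFDerivAt_const (fderivRight conj (x, o)) o)).congr_of_eventuallyEq hx
    have h4 := h2.unique h3
    rw [h.fderiv_fderivRight_conj_eq_zero hsymm] at h4
    obtain ⟨U, hU⟩ := hu
    have hR : fderivLeft mul (o, x) ∘L (↑U⁻¹ : E →L[ℂ] E) = .id ℂ E := by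
      rw [← hU]; exact U.mul_inv
    have h5 : fderiv ℂ (fun x => fderivRight conj (x, o)) x ∘L fderivLeft mul (o, x) = 0 := by
      rw [h4]; ext; simp
    calc fderiv ℂ (fun x => fderivRight conj (x, o)) x
        = fderiv ℂ (fun x => fderivRight conj (x, o)) x ∘L (fderivLeft mul (o, x) ∘L ↑U⁻¹) := by
          rw [hR, ContinuousLinearMap.comp_id]
      _ = 0 := by rw [← ContinuousLinearMap.comp_assoc, h5, ContinuousLinearMap.zero_comp]
  obtain ⟨ε, hε, hball⟩ := Metric.eventually_nhds_iff_ball.1 (hdc.and hzero)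
  filter_upwards [Metric.ball_mem_nhds o hε] with x hx
  rw [← h.fderivRight_conj_one]
  exact Metric.isOpen_ball.is_const_of_fderiv_eq_zero (𝕜 := ℂ)
    (convex_ball o ε).isPreconnected
    (fun y hy => (hball y hy).1.differentiableAt.differentiableWithinAt)
    (fun y hy => (hball y hy).2) hx (Metric.mem_ball_self hε)

/-- If the bracket vanishes, then the vector fields generating conjugation vanish. This is seen by
differentiating `conj (y, x) y = y x` in `y` at the neutral element, where `R = L` because `Ad` is
trivial. -/
theorem fderivLeft_conj_eq_zero [CompleteSpace E] (h : IsLocalGroupLaw o mul conj)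
    (hsymm : ∀ u v, fderiv ℂ (fun x => fderivLeft mul (o, x)) o u v =
      fderiv ℂ (fun x => fderivLeft mul (o, x)) o v u) :
    ∀ᶠ x in 𝓝 o, fderivLeft conj (o, x) = 0 := by
  filter_upwards [h.conj_mul.curry_nhds_right, h.one_conj, h.fderivLeft_mul_one,
    h.fderivLeft_mul_comp_fderivRight_conj, h.fderivRight_conj_eq_id hsymm,
    (eventually_differentiableAt h.contDiffAt_conj).curry_nhds_right,
    (eventually_differentiableAt h.contDiffAt_mul).curry_nhds_right,
    (eventually_differentiableAt h.contDiffAt_mul).curry_nhds] with x hx hx1 h1 h2 h3 hdc hd hd'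
  have h4 : HasFDerivAt (fun y => (conj (y, x), y)) _ o :=
    (hasFDerivAt_fderivLeft hdc.self_of_nhds).prodMk (hasFDerivAt_id o)
  have h5 : HasFDerivAt mul (fderiv ℂ mul (x, o)) (conj (o, x), o) := by
    rw [hx1]; exact hd'.self_of_nhds.hasFDerivAt
  have h6 := (HasFDerivAt.comp (g := mul) (f := fun y => (conj (y, x), y)) o h5 h4).unique
    ((hasFDerivAt_fderivLeft hd.self_of_nhds).congr_of_eventuallyEq hx)
  rw [h3, ContinuousLinearMap.comp_id] at h2
  have hadd (v w : E) : fderiv ℂ mul (x, o) (v, w) = fderivLeft mul (x, o) v +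
      fderivRight mul (x, o) w := by
    simp [fderivLeft, fderivRight, ← map_add]
  ext v
  have h7 := congrArg (fun L => L v) h6
  simp [hadd, h1, h2] at h7
  exact h7

/-- A local group law with vanishing bracket is commutative near the neutral element. -/
theorem conj_eq_of_symm [CompleteSpace E] (h : IsLocalGroupLaw o mul conj)
    (hsymm : ∀ u v, fderiv ℂ (fun x => fderivLeft mul (o, x)) o u v =
      fderiv ℂ (fun x => fderivLeft mul (o, x)) o v u) :
    ∀ᶠ z : E × E in 𝓝 (o, o), conj z = z.2 := by
  -- differentiate `conj (y x, w) = conj (y, conj (x, w))` in `y` at the neutral element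
  have hzero : ∀ᶠ z : E × E in 𝓝 (o, o), fderivLeft conj z = 0 := by
    have h4 : ∀ᶠ z : E × (E × E) in 𝓝 (o, (o, o)),
        conj (mul (z.1, z.2.1), z.2.2) = conj (z.1, conj (z.2.1, z.2.2)) := h.mul_conj
    have hfst : Filter.Tendsto Prod.fst (𝓝 (o, o)) (𝓝 o) := continuousAt_fst (p := (o, o))
    filter_upwards [h4.curry_nhds_right, hfst.eventually h.one_mul,
      h.tendsto_conj.eventually (h.fderivLeft_conj_eq_zero hsymm),
      h.tendsto_conj.eventually (eventually_differentiableAt h.contDiffAt_conj).curry_nhds_right,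
      hfst.eventually (eventually_differentiableAt h.contDiffAt_mul).curry_nhds_right,
      hfst.eventually h.isInvertible_fderivLeft_mul,
      eventually_differentiableAt h.contDiffAt_conj] with z hz h1 h2 h3 h5 hu hdz
    have h6 : HasFDerivAt (fun x => conj (x, z.2)) (fderivLeft conj z) (mul (o, z.1)) := by
      rw [h1]; exact hasFDerivAt_fderivLeft hdz
    have h7 := HasFDerivAt.comp (g := fun x => conj (x, z.2)) o h6
      (hasFDerivAt_fderivLeft h5.self_of_nhds)
    have h8 := h7.unique ((hasFDerivAt_fderivLeft h3.self_of_nhds).congr_of_eventuallyEq hz)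
    rw [h2] at h8
    obtain ⟨U, hU⟩ := hu
    have hR : fderivLeft mul (o, z.1) ∘L (↑U⁻¹ : E →L[ℂ] E) = .id ℂ E := by
      rw [← hU]; exact U.mul_inv
    calc fderivLeft conj z = fderivLeft conj z ∘L (fderivLeft mul (o, z.1) ∘L ↑U⁻¹) := by
          rw [hR, ContinuousLinearMap.comp_id]
      _ = 0 := by rw [← ContinuousLinearMap.comp_assoc, h8, ContinuousLinearMap.zero_comp]
  have hone : ∀ᶠ z : E × E in 𝓝 (o, o), conj (o, z.2) = z.2 :=
    (continuousAt_snd (p := (o, o))).eventually h.one_conj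
  obtain ⟨ε, hε, hball⟩ := Metric.eventually_nhds_iff_ball.1
    ((hzero.and (eventually_differentiableAt h.contDiffAt_conj)).and hone)
  filter_upwards [Metric.ball_mem_nhds (o, o) hε] with z hz
  rw [← (hball z hz).2]
  rw [← ball_prod_same] at hz hball
  exact Metric.isOpen_ball.is_const_of_fderiv_eq_zero (𝕜 := ℂ) (f := fun x => conj (x, z.2))
    (convex_ball o ε).isPreconnected
    (fun y hy => (hasFDerivAt_fderivLeft
      (hball (y, z.2) ⟨hy, hz.2⟩).1.2).differentiableAt.differentiableWithinAt)
    (fun y hy => (hasFDerivAt_fderivLeft (hball (y, z.2) ⟨hy, hz.2⟩).1.2).fderiv.trans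
      (hball (y, z.2) ⟨hy, hz.2⟩).1.1) hz.1 (Metric.mem_ball_self hε)

end IsLocalGroupLaw

end LocalGroup

/-! ### The local group law of a complex Lie group -/

section LieGroupLaw

variable {E : Type*} [NormedAddCommGroup E] [NormedSpace ℂ E]
  {G : Type*} [Group G] [TopologicalSpace G] [ChartedSpace E G]

/-- The multiplication of a Lie group read in the preferred chart at `1`. -/
def chartMul (E G : Type*) [NormedAddCommGroup E] [NormedSpace ℂ E] [Group G] [TopologicalSpace G]
    [ChartedSpace E G] (z : E × E) : E :=
  chartAt E (1 : G) ((chartAt E (1 : G)).symm z.1 * (chartAt E (1 : G)).symm z.2)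

/-- The conjugation `x y x⁻¹` of a Lie group read in the preferred chart at `1`. -/
def chartConj (E G : Type*) [NormedAddCommGroup E] [NormedSpace ℂ E] [Group G] [TopologicalSpace G]
    [ChartedSpace E G] (z : E × E) : E :=
  chartAt E (1 : G) ((chartAt E (1 : G)).symm z.1 * (chartAt E (1 : G)).symm z.2 *
    ((chartAt E (1 : G)).symm z.1)⁻¹)

/-- The coordinate of the neutral element in the preferred chart at `1`. -/
def chartOne (E G : Type*) [NormedAddCommGroup E] [NormedSpace ℂ E] [Group G] [TopologicalSpace G]
    [ChartedSpace E G] : E := chartAt E (1 : G) (1 : G)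

theorem chartOne_mem_target : chartOne E G ∈ (chartAt E (1 : G)).target :=
  mem_chart_target E (1 : G)

@[simp]
theorem chartAt_symm_chartOne : (chartAt E (1 : G)).symm (chartOne E G) = 1 :=
  (chartAt E (1 : G)).left_inv (mem_chart_source E 1)

variable [LieGroup 𝓘(ℂ, E) ω G]

theorem contMDiffAt_chartAt_symm {w : E} (hw : w ∈ (chartAt E (1 : G)).target) :
    ContMDiffAt 𝓘(ℂ, E) 𝓘(ℂ, E) ω (chartAt E (1 : G)).symm w :=
  contMDiffAt_symm_of_mem_maximalAtlas (IsManifold.chart_mem_maximalAtlas 1) hw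

theorem contMDiffAt_chartAt_one {x : G} (hx : x ∈ (chartAt E (1 : G)).source) :
    ContMDiffAt 𝓘(ℂ, E) 𝓘(ℂ, E) ω (chartAt E (1 : G)) x :=
  contMDiffAt_of_mem_maximalAtlas (IsManifold.chart_mem_maximalAtlas 1) hx

theorem contMDiffAt_chartAt_symm_comp {X : Type*} [NormedAddCommGroup X] [NormedSpace ℂ X]
    (L : X →L[ℂ] E) {z : X} (hz : L z = chartOne E G) :
    ContMDiffAt 𝓘(ℂ, X) 𝓘(ℂ, E) ω (fun z => (chartAt E (1 : G)).symm (L z)) z := by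
  refine ContMDiffAt.comp z (g := (chartAt E (1 : G)).symm) (f := L) ?_
    L.contDiff.contDiffAt.contMDiffAt
  rw [hz]
  exact contMDiffAt_chartAt_symm chartOne_mem_target

theorem contDiffAt_chartMul :
    ContDiffAt ℂ ω (chartMul E G) (chartOne E G, chartOne E G) := by
  rw [← contMDiffAt_iff_contDiffAt]
  have h1 := contMDiffAt_chartAt_symm_comp (G := G) (ContinuousLinearMap.fst ℂ E E)
    (z := (chartOne E G, chartOne E G)) rfl
  have h2 := contMDiffAt_chartAt_symm_comp (G := G) (ContinuousLinearMap.snd ℂ E E)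
    (z := (chartOne E G, chartOne E G)) rfl
  refine ContMDiffAt.comp _ (g := chartAt E (1 : G)) (contMDiffAt_chartAt_one ?_) (h1.mul h2)
  simp

theorem contDiffAt_chartConj :
    ContDiffAt ℂ ω (chartConj E G) (chartOne E G, chartOne E G) := by
  rw [← contMDiffAt_iff_contDiffAt]
  have h1 := contMDiffAt_chartAt_symm_comp (G := G) (ContinuousLinearMap.fst ℂ E E)
    (z := (chartOne E G, chartOne E G)) rfl
  have h2 := contMDiffAt_chartAt_symm_comp (G := G) (ContinuousLinearMap.snd ℂ E E)
    (z := (chartOne E G, chartOne E G)) rfl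
  refine ContMDiffAt.comp _ (g := chartAt E (1 : G)) (contMDiffAt_chartAt_one ?_)
    ((h1.mul h2).mul h1.inv)
  simp

theorem tendsto_chartAt_symm_one :
    Filter.Tendsto (chartAt E (1 : G)).symm (𝓝 (chartOne E G)) (𝓝 1) := by
  have h := (contMDiffAt_chartAt_symm (E := E) (G := G) chartOne_mem_target).continuousAt.tendsto
  rwa [chartAt_symm_chartOne] at h

theorem tendsto_chartAt_symm_fst : Filter.Tendsto (fun z : E × E => (chartAt E (1 : G)).symm z.1)
    (𝓝 (chartOne E G, chartOne E G)) (𝓝 1) :=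
  tendsto_chartAt_symm_one.comp (continuous_fst.tendsto' _ _ rfl)

theorem tendsto_chartAt_symm_snd : Filter.Tendsto (fun z : E × E => (chartAt E (1 : G)).symm z.2)
    (𝓝 (chartOne E G, chartOne E G)) (𝓝 1) :=
  tendsto_chartAt_symm_one.comp (continuous_snd.tendsto' _ _ rfl)

/-- Near the neutral element, products stay in the domain of the chart. -/
theorem eventually_chartAt_symm_chartMul :
    ∀ᶠ z : E × E in 𝓝 (chartOne E G, chartOne E G), (chartAt E (1 : G)).symm (chartMul E G z) =
      (chartAt E (1 : G)).symm z.1 * (chartAt E (1 : G)).symm z.2 := by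
  have := topologicalGroup_of_lieGroup (G := G) 𝓘(ℂ, E) ω
  have h : Filter.Tendsto (fun z : E × E => (chartAt E (1 : G)).symm z.1 *
      (chartAt E (1 : G)).symm z.2) (𝓝 (chartOne E G, chartOne E G)) (𝓝 (1 * 1)) :=
    tendsto_chartAt_symm_fst.mul tendsto_chartAt_symm_snd
  rw [one_mul] at h
  filter_upwards [h (chart_source_mem_nhds E 1)] with z hz
  exact (chartAt E (1 : G)).left_inv hz

/-- Near the neutral element, conjugates stay in the domain of the chart. -/
theorem eventually_chartAt_symm_chartConj :
    ∀ᶠ z : E × E in 𝓝 (chartOne E G, chartOne E G), (chartAt E (1 : G)).symm (chartConj E G z) =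
      (chartAt E (1 : G)).symm z.1 * (chartAt E (1 : G)).symm z.2 *
        ((chartAt E (1 : G)).symm z.1)⁻¹ := by
  have := topologicalGroup_of_lieGroup (G := G) 𝓘(ℂ, E) ω
  have h : Filter.Tendsto (fun z : E × E => (chartAt E (1 : G)).symm z.1 *
      (chartAt E (1 : G)).symm z.2 * ((chartAt E (1 : G)).symm z.1)⁻¹)
      (𝓝 (chartOne E G, chartOne E G)) (𝓝 (1 * 1 * 1⁻¹)) :=
    (tendsto_chartAt_symm_fst.mul tendsto_chartAt_symm_snd).mul tendsto_chartAt_symm_fst.inv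
  rw [one_mul, inv_one, one_mul] at h
  filter_upwards [h (chart_source_mem_nhds E 1)] with z hz
  exact (chartAt E (1 : G)).left_inv hz

theorem isLocalGroupLaw_chartMul :
    IsLocalGroupLaw (chartOne E G) (chartMul E G) (chartConj E G) where
  contDiffAt_mul := contDiffAt_chartMul.of_le le_top
  contDiffAt_conj := contDiffAt_chartConj.of_le le_top
  one_mul := by
    filter_upwards [(chartAt E (1 : G)).open_target.mem_nhds chartOne_mem_target] with v hv
    simp [chartMul, (chartAt E (1 : G)).right_inv hv]
  mul_one := by
    filter_upwards [(chartAt E (1 : G)).open_target.mem_nhds chartOne_mem_target] with v hv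
    simp [chartMul, (chartAt E (1 : G)).right_inv hv]
  one_conj := by
    filter_upwards [(chartAt E (1 : G)).open_target.mem_nhds chartOne_mem_target] with v hv
    simp [chartConj, (chartAt E (1 : G)).right_inv hv]
  conj_one := .of_forall fun v => by simp [chartConj, chartOne]
  conj_mul := by
    filter_upwards [eventually_chartAt_symm_chartConj] with z hz
    simp [chartMul, hz]
  mul_conj := by
    have hc : ContinuousAt (chartConj E G) (chartOne E G, chartOne E G) :=
      contDiffAt_chartConj.continuousAt
    have h1 : Filter.Tendsto (fun z : E × E × E => (z.1, z.2.1))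
        (𝓝 (chartOne E G, chartOne E G, chartOne E G)) (𝓝 (chartOne E G, chartOne E G)) :=
      Continuous.tendsto' (by fun_prop) _ _ rfl
    have h2 : Filter.Tendsto (fun z : E × E × E => z.2)
        (𝓝 (chartOne E G, chartOne E G, chartOne E G)) (𝓝 (chartOne E G, chartOne E G)) :=
      Continuous.tendsto' (by fun_prop) _ _ rfl
    filter_upwards [h1.eventually eventually_chartAt_symm_chartMul,
      h2.eventually eventually_chartAt_symm_chartConj] with z hz1 hz2
    simp only [chartConj] at hz2 ⊢
    rw [hz1, hz2]
    simp [mul_assoc]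

/-- A connected complex Lie group whose bracket vanishes is commutative. The bracket appears as the
antisymmetric part of the second order term of the group law in a chart. -/
theorem mul_comm_of_symm [CompleteSpace E] [ConnectedSpace G]
    (hsymm : ∀ u v, fderiv ℂ (fun x => fderivLeft (chartMul E G) (chartOne E G, x)) (chartOne E G)
        u v = fderiv ℂ (fun x => fderivLeft (chartMul E G) (chartOne E G, x)) (chartOne E G) v u)
    (x y : G) : x * y = y * x := by
  have := topologicalGroup_of_lieGroup (G := G) 𝓘(ℂ, E) ω
  have h := isLocalGroupLaw_chartMul.conj_eq_of_symm hsymm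
  have hcomm : ∀ᶠ z : G × G in 𝓝 (1, 1), z.1 * z.2 = z.2 * z.1 := by
    have hc : Filter.Tendsto (fun z : G × G => (chartAt E (1 : G) z.1, chartAt E (1 : G) z.2))
        (𝓝 (1, 1)) (𝓝 (chartOne E G, chartOne E G)) := by
      have hc1 : ContinuousAt (chartAt E (1 : G)) (1 : G) :=
        (contMDiffAt_chartAt_one (mem_chart_source E 1)).continuousAt
      exact (hc1.tendsto.comp (continuousAt_fst (p := ((1 : G), (1 : G))))).prodMk_nhds
        (hc1.tendsto.comp (continuousAt_snd (p := ((1 : G), (1 : G)))))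
    filter_upwards [hc.eventually h, hc.eventually eventually_chartAt_symm_chartConj,
      (continuousAt_fst (p := ((1 : G), (1 : G)))).eventually (chart_source_mem_nhds E 1),
      (continuousAt_snd (p := ((1 : G), (1 : G)))).eventually (chart_source_mem_nhds E 1)]
      with z h1 h2 h3 h4
    rw [h1] at h2
    have e1 : (chartAt E (1 : G)).symm (chartAt E (1 : G) z.1) = z.1 := (chartAt E 1).left_inv h3
    have e2 : (chartAt E (1 : G)).symm (chartAt E (1 : G) z.2) = z.2 := (chartAt E 1).left_inv h4
    simp only [e1, e2] at h2
    exact (eq_mul_inv_iff_mul_eq.1 h2).symm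
  -- a subgroup containing a neighborhood of `1` is everything
  have htop (H : Subgroup G) (hH : (H : Set G) ∈ 𝓝 1) : H = ⊤ := by
    have ho : IsOpen (H : Set G) := H.isOpen_of_mem_nhds hH
    have hcl : IsClopen (H : Set G) := ⟨H.isClosed_of_isOpen ho, ho⟩
    exact SetLike.coe_injective (hcl.eq_univ ⟨1, H.one_mem⟩)
  obtain ⟨U, hU, V, hV, hUV⟩ := mem_nhds_prod_iff.1 hcomm
  have h1 : Subgroup.centralizer U = ⊤ := htop _ (Filter.mem_of_superset hV fun v hv =>
    Subgroup.mem_centralizer_iff.2 fun u hu => hUV (Set.mk_mem_prod hu hv))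
  have h2 : Subgroup.center G = ⊤ := htop _ (Filter.mem_of_superset hU fun u hu =>
    Subgroup.mem_center_iff.2 fun g => by
      have : g ∈ Subgroup.centralizer U := h1 ▸ Subgroup.mem_top g
      exact (Subgroup.mem_centralizer_iff.1 this u hu).symm)
  have hy : y ∈ Subgroup.center G := h2 ▸ Subgroup.mem_top y
  exact Subgroup.mem_center_iff.1 hy x

end LieGroupLaw

/-! ### Charts of the quotient by right translates -/

section QuotientCharts

variable {E : Type*} [NormedAddCommGroup E] [NormedSpace ℂ E]
  {G : Type*} [Group G] [TopologicalSpace G] [ChartedSpace E G] [LieGroup 𝓘(ℂ, E) ω G]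
  (Γ : Subgroup G) [DiscreteTopology Γ]

/-- The projection `G → G ⧸ Γ` is holomorphic. -/
theorem contMDiff_quotientGroup_mk :
    ContMDiff 𝓘(ℂ, E) 𝓘(ℂ, E) ω (QuotientGroup.mk : G → G ⧸ Γ) := by
  have := topologicalGroup_of_lieGroup (G := G) 𝓘(ℂ, E) ω
  have hf := isLocalHomeomorph_quotientGroup_mk Γ
  intro a
  -- the representative that defines the preferred chart at the class of `a`
  let b : G := (QuotientGroup.mk_surjective (s := Γ)).hasRightInverse.choose (QuotientGroup.mk a)
  have hb : (QuotientGroup.mk b : G ⧸ Γ) = QuotientGroup.mk a :=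
    (QuotientGroup.mk_surjective (s := Γ)).hasRightInverse.choose_spec _
  have hγ : a⁻¹ * b ∈ Γ := QuotientGroup.eq.1 hb.symm
  let χ := chartAt E (QuotientGroup.mk a : G ⧸ Γ)
  have hχ : χ = (hf.localInverseAt b).trans (chartAt E b) := rfl
  have hbs : chartAt E b b ∈ χ.target := by
    rw [hχ]
    simp [hf.self_mem_localInverseAt_target]
  have h1 : ContMDiffAt 𝓘(ℂ, E) 𝓘(ℂ, E) ω (fun x => χ.symm (chartAt E b x)) b :=
    ContMDiffAt.comp b (g := χ.symm) (f := chartAt E b)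
      (contMDiffAt_symm_of_mem_maximalAtlas (IsManifold.chart_mem_maximalAtlas _) hbs)
      (contMDiffAt_of_mem_maximalAtlas (IsManifold.chart_mem_maximalAtlas b) (mem_chart_source E b))
  have h2 : ContMDiffAt 𝓘(ℂ, E) 𝓘(ℂ, E) ω (QuotientGroup.mk : G → G ⧸ Γ) b := by
    refine h1.congr_of_eventuallyEq ?_
    filter_upwards [chart_source_mem_nhds E b] with x hx
    rw [hχ, OpenPartialHomeomorph.trans_symm_eq_symm_trans_symm, OpenPartialHomeomorph.coe_trans,
      Function.comp_apply, (chartAt E b).left_inv hx, hf.localInverseAt_symm]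
  have h3 : ContMDiffAt 𝓘(ℂ, E) 𝓘(ℂ, E) ω (fun x => (QuotientGroup.mk (x * (a⁻¹ * b)) : G ⧸ Γ)) a :=
    ContMDiffAt.comp a (g := (QuotientGroup.mk : G → G ⧸ Γ)) (f := (· * (a⁻¹ * b)))
      (by simpa using h2) (contMDiff_mul_right (I := 𝓘(ℂ, E))).contMDiffAt
  refine h3.congr_of_eventuallyEq (.of_forall fun x => ?_)
  exact (QuotientGroup.mk_mul_of_mem x hγ).symm

/-- Local inverses of the projection `G → G ⧸ Γ` are holomorphic. -/
theorem contMDiffAt_localInverseAt [IsTopologicalGroup G] (a : G) {q : G ⧸ Γ}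
    (hq : q ∈ ((isLocalHomeomorph_quotientGroup_mk Γ).localInverseAt a).source) :
    ContMDiffAt 𝓘(ℂ, E) 𝓘(ℂ, E) ω ((isLocalHomeomorph_quotientGroup_mk Γ).localInverseAt a) q := by
  have hf := isLocalHomeomorph_quotientGroup_mk Γ
  let b : G := (QuotientGroup.mk_surjective (s := Γ)).hasRightInverse.choose q
  have hb : (QuotientGroup.mk b : G ⧸ Γ) = q :=
    (QuotientGroup.mk_surjective (s := Γ)).hasRightInverse.choose_spec _
  let χ := chartAt E q
  let s := hf.localInverseAt a
  let t := hf.localInverseAt b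
  have hχ : χ = t.trans (chartAt E b) := rfl
  have hqt : q ∈ t.source := by rw [← hb]; exact hf.apply_self_mem_localInverseAt_source
  have hqχ : q ∈ χ.source := mem_chart_source E q
  have htb : t q ∈ (chartAt E b).source := by
    have := hqχ
    rw [hχ, OpenPartialHomeomorph.trans_source] at this
    exact this.2
  have h1 : ContMDiffAt 𝓘(ℂ, E) 𝓘(ℂ, E) ω (fun x => (chartAt E b).symm (χ x)) q := by
    refine ContMDiffAt.comp q (g := (chartAt E b).symm) (f := χ)
      (contMDiffAt_symm_of_mem_maximalAtlas (IsManifold.chart_mem_maximalAtlas _) ?_)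
      (contMDiffAt_of_mem_maximalAtlas (IsManifold.chart_mem_maximalAtlas q) hqχ)
    exact (chartAt E b).map_source htb
  have h2 : ContMDiffAt 𝓘(ℂ, E) 𝓘(ℂ, E) ω t q := by
    refine h1.congr_of_eventuallyEq ?_
    filter_upwards [χ.open_source.mem_nhds hqχ] with x hx
    rw [hχ, OpenPartialHomeomorph.trans_source] at hx
    exact ((chartAt E b).left_inv hx.2).symm
  -- two local inverses differ by right translation by an element of `Γ`
  have hst : (QuotientGroup.mk (t q) : G ⧸ Γ) = QuotientGroup.mk (s q) :=
    (hf.apply_localInverseAt_of_mem hqt).trans (hf.apply_localInverseAt_of_mem hq).symm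
  have hγ : (t q)⁻¹ * s q ∈ Γ := QuotientGroup.eq.1 hst
  have h3 : ContMDiffAt 𝓘(ℂ, E) 𝓘(ℂ, E) ω (fun x => t x * ((t q)⁻¹ * s q)) q :=
    ContMDiffAt.comp q (g := (· * ((t q)⁻¹ * s q))) (f := t)
      (contMDiff_mul_right (I := 𝓘(ℂ, E))).contMDiffAt h2
  refine h3.congr_of_eventuallyEq ?_
  have h4 : ∀ᶠ x in 𝓝 q, t x * ((t q)⁻¹ * s q) ∈ s.target :=
    h3.continuousAt.eventually_mem (s.open_target.mem_nhds (by simpa using s.map_source hq))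
  filter_upwards [h4, s.open_source.mem_nhds hq, t.open_source.mem_nhds hqt] with x hx hxs hxt
  refine hf.injOn_localInverseAt_target (s.map_source hxs) hx ?_
  rw [hf.apply_localInverseAt_of_mem hxs, QuotientGroup.mk_mul_of_mem _ hγ,
    hf.apply_localInverseAt_of_mem hxt]

/-- The chart of `G ⧸ Γ` near the class of `a` whose inverse is `w ↦ σ w • a`, where `σ` is the
inverse of the preferred chart of `G` at `1`. -/
def rightTranslateChart [IsTopologicalGroup G] (a : G) : OpenPartialHomeomorph (G ⧸ Γ) E :=
  (((isLocalHomeomorph_quotientGroup_mk Γ).localInverseAt a).trans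
    (Homeomorph.mulRight a⁻¹).toOpenPartialHomeomorph).trans (chartAt E (1 : G))

omit [LieGroup 𝓘(ℂ, E) ω G] [NormedSpace ℂ E] in
theorem rightTranslateChart_symm_apply [IsTopologicalGroup G] (a : G) (w : E) :
    (rightTranslateChart Γ a).symm w =
      (chartAt E (1 : G)).symm w • (QuotientGroup.mk a : G ⧸ Γ) := by
  rw [rightTranslateChart, OpenPartialHomeomorph.trans_symm_eq_symm_trans_symm,
    OpenPartialHomeomorph.trans_symm_eq_symm_trans_symm]
  simp [IsLocalHomeomorph.localInverseAt_symm, MulAction.Quotient.smul_mk,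
    Homeomorph.mulRight_symm, Homeomorph.coe_mulRight]

omit [LieGroup 𝓘(ℂ, E) ω G] in
theorem chartOne_mem_rightTranslateChart_target [IsTopologicalGroup G] (a : G) :
    chartOne E G ∈ (rightTranslateChart (E := E) Γ a).target := by
  have := chartOne_mem_target (E := E) (G := G)
  simp [rightTranslateChart, this, Homeomorph.mulRight_symm, Homeomorph.coe_mulRight,
    (isLocalHomeomorph_quotientGroup_mk Γ).self_mem_localInverseAt_target]

theorem contMDiffAt_chartAt_symm_smul (p : G ⧸ Γ) {w : E} (hw : w ∈ (chartAt E (1 : G)).target) :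
    ContMDiffAt 𝓘(ℂ, E) 𝓘(ℂ, E) ω (fun w => (chartAt E (1 : G)).symm w • p) w := by
  obtain ⟨a, rfl⟩ := QuotientGroup.mk_surjective p
  have h1 : ContMDiffAt 𝓘(ℂ, E) 𝓘(ℂ, E) ω (fun w => (chartAt E (1 : G)).symm w * a) w :=
    ContMDiffAt.comp w (g := (· * a)) (contMDiff_mul_right (I := 𝓘(ℂ, E))).contMDiffAt
      (contMDiffAt_chartAt_symm hw)
  exact ContMDiffAt.comp w (g := (QuotientGroup.mk : G → G ⧸ Γ))
    (contMDiff_quotientGroup_mk Γ).contMDiffAt h1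

theorem rightTranslateChart_mem_maximalAtlas [IsTopologicalGroup G] (a : G) :
    rightTranslateChart Γ a ∈ IsManifold.maximalAtlas 𝓘(ℂ, E) ω (G ⧸ Γ) := by
  refine OpenPartialHomeomorph.mem_maximalAtlas_of_contMDiffOn _ (fun q hq => ?_) fun w hw => ?_
  · have hq' := hq
    simp only [rightTranslateChart, OpenPartialHomeomorph.trans_source, Set.mem_inter_iff,
      Set.mem_preimage] at hq'
    have h1 := contMDiffAt_localInverseAt (E := E) Γ a hq'.1.1
    have h2 : ContMDiffAt 𝓘(ℂ, E) 𝓘(ℂ, E) ω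
        (fun q => (isLocalHomeomorph_quotientGroup_mk Γ).localInverseAt a q * a⁻¹) q :=
      ContMDiffAt.comp q (g := (· * a⁻¹)) (contMDiff_mul_right (I := 𝓘(ℂ, E))).contMDiffAt h1
    exact (ContMDiffAt.comp q (g := chartAt E (1 : G)) (contMDiffAt_chartAt_one hq'.2)
      h2).contMDiffWithinAt
  · have hw' : w ∈ (chartAt E (1 : G)).target := by
      rw [rightTranslateChart, OpenPartialHomeomorph.trans_target] at hw
      exact hw.1
    refine ((contMDiffAt_chartAt_symm_smul Γ (QuotientGroup.mk a) hw').congr_of_eventuallyEq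
      (.of_forall fun w => ?_)).contMDiffWithinAt
    exact rightTranslateChart_symm_apply Γ a w

end QuotientCharts

/-! ### Pulling back the fundamental form -/

section Pullback

variable {E : Type*} [NormedAddCommGroup E] [NormedSpace ℂ E]
  {M : Type*} [TopologicalSpace M] [ChartedSpace E M] [IsManifold 𝓘(ℂ, E) ω M]

/-- The pullback of the fundamental form of a Hermitian metric under a map from the model space. -/
def HermitianMetric.pullbackForm (g : HermitianMetric E M) (Φ : E → M) (w : E) :
    E [⋀^Fin 2]→L[ℝ] ℂ :=
  Complex.ofRealCLM.compContinuousAlternatingMap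
    ((g.fundamentalForm (Φ w)).compContinuousLinearMap (mfderiv 𝓘(ℝ, E) 𝓘(ℝ, E) Φ w))

/-- The metric at a point as a bilinear form on the model space, which is the tangent space. -/
def HermitianMetric.modelInner (g : HermitianMetric E M) (p : M) : E →L[ℝ] E →L[ℝ] ℝ := g.inner p

/-- The derivative of a map into a manifold as a linear map of the model space, with which Mathlib
identifies the tangent spaces. -/
def modelDeriv (Φ : E → M) (w : E) : E →L[ℝ] E := mfderiv 𝓘(ℝ, E) 𝓘(ℝ, E) Φ w

theorem HermitianMetric.pullbackForm_apply (g : HermitianMetric E M) (Φ : E → M) (w s t : E) :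
    g.pullbackForm Φ w ![s, t] =
      (g.modelInner (Φ w) (Complex.I • modelDeriv Φ w s) (modelDeriv Φ w t) : ℂ) := rfl

theorem HermitianMetric.pullbackForm_congr (g : HermitianMetric E M) {Φ Ψ : E → M} {w : E}
    (h : Φ =ᶠ[𝓝 w] Ψ) : g.pullbackForm Φ w = g.pullbackForm Ψ w := by
  have hd : modelDeriv Φ w = modelDeriv Ψ w := h.mfderiv_eq
  refine continuousAlternatingMap_two_ext fun s t => ?_
  rw [g.pullbackForm_apply, g.pullbackForm_apply, hd, h.self_of_nhds]

theorem HermitianMetric.pullbackForm_comp (g : HermitianMetric E M) {Φ : E → M} {f : E → E}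
    {f' : E →L[ℂ] E} {w : E} (hΦ : MDifferentiableAt 𝓘(ℝ, E) 𝓘(ℝ, E) Φ (f w))
    (hf : HasFDerivAt f f' w) (s t : E) :
    g.pullbackForm (fun w => Φ (f w)) w ![s, t] = g.pullbackForm Φ (f w) ![f' s, f' t] := by
  have hf' := (hf.restrictScalars ℝ).hasMFDerivAt
  have hd : modelDeriv (fun w => Φ (f w)) w = modelDeriv Φ (f w) ∘L f'.restrictScalars ℝ :=
    (HasMFDerivAt.comp w hΦ.hasMFDerivAt hf').mfderiv
  rw [g.pullbackForm_apply, g.pullbackForm_apply, hd]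
  rfl

omit [IsManifold 𝓘(ℂ, E) ω M] in
theorem ContMDiffAt.restrictScalars_real {N : Type*} [TopologicalSpace N] [ChartedSpace E N]
    {Φ : N → M} {w : N} {n : WithTop ℕ∞}
    (hΦ : ContMDiffAt 𝓘(ℂ, E) 𝓘(ℂ, E) n Φ w) : ContMDiffAt 𝓘(ℝ, E) 𝓘(ℝ, E) n Φ w := by
  rw [contMDiffAt_iff] at hΦ ⊢
  exact ⟨hΦ.1, hΦ.2.restrict_scalars ℝ⟩

omit [IsManifold 𝓘(ℂ, E) ω M] in
theorem modelDeriv_smul_I {Φ : E → M} {w : E} (hΦ : MDifferentiableAt 𝓘(ℂ, E) 𝓘(ℂ, E) Φ w)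
    (s : E) : modelDeriv Φ w (Complex.I • s) = Complex.I • modelDeriv Φ w s := by
  have h := hΦ.hasMFDerivAt
  let L : E →L[ℂ] E := mfderiv 𝓘(ℂ, E) 𝓘(ℂ, E) Φ w
  have h2 : HasMFDerivAt 𝓘(ℝ, E) 𝓘(ℝ, E) Φ w (L.restrictScalars ℝ) :=
    ⟨h.1, h.2.restrictScalars ℝ⟩
  have h3 : modelDeriv Φ w = L.restrictScalars ℝ := h2.mfderiv
  rw [h3]
  exact L.map_smul Complex.I s

theorem HermitianMetric.modelInner_smul_I (g : HermitianMetric E M) (p : M) (s t : E) :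
    g.modelInner p (Complex.I • s) (Complex.I • t) = g.modelInner p s t := g.inner_J p s t

theorem HermitianMetric.pullbackForm_smul_I (g : HermitianMetric E M) {Φ : E → M} {w : E}
    (hΦ : MDifferentiableAt 𝓘(ℂ, E) 𝓘(ℂ, E) Φ w) (s t : E) :
    g.pullbackForm Φ w ![Complex.I • s, Complex.I • t] = g.pullbackForm Φ w ![s, t] := by
  rw [g.pullbackForm_apply, g.pullbackForm_apply, modelDeriv_smul_I hΦ, modelDeriv_smul_I hΦ,
    g.modelInner_smul_I]

theorem HermitianMetric.pullbackForm_self_smul_I (g : HermitianMetric E M) {Φ : E → M} {w : E}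
    (hΦ : MDifferentiableAt 𝓘(ℂ, E) 𝓘(ℂ, E) Φ w) (s : E) :
    g.pullbackForm Φ w ![s, Complex.I • s] =
      (g.modelInner (Φ w) (modelDeriv Φ w s) (modelDeriv Φ w s) : ℂ) := by
  rw [g.pullbackForm_apply, modelDeriv_smul_I hΦ, g.modelInner_smul_I]

open Bundle in
/-- The vector field `w ↦ dΦ_w s` along a smooth map `Φ` is smooth. -/
theorem contMDiffAt_mfderiv_apply_const {Φ : E → M} {w : E}
    (hΦ : ContMDiffAt 𝓘(ℝ, E) 𝓘(ℝ, E) ω Φ w) (s : E) :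
    ContMDiffAt 𝓘(ℝ, E) 𝓘(ℝ, E).tangent ∞
      (fun y => TotalSpace.mk' E (E := fun x : M => TangentSpace 𝓘(ℝ, E) x) (Φ y)
        (mfderiv 𝓘(ℝ, E) 𝓘(ℝ, E) Φ y s)) w := by
  obtain ⟨u, hu, hΦu⟩ := (contMDiffAt_iff_contMDiffOn_nhds (by simp)).1 hΦ
  have hΦi : ContMDiffOn 𝓘(ℝ, E) 𝓘(ℝ, E) ω Φ (interior u) := hΦu.mono interior_subset
  have hw : w ∈ interior u := mem_interior_iff_mem_nhds.2 hu
  have hT := hΦi.contMDiffOn_tangentMapWithin (m := ∞) (by simp)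
    isOpen_interior.uniqueMDiffOn
  have hs : ContMDiffAt 𝓘(ℝ, E) 𝓘(ℝ, E).tangent ∞
      (fun y => (TotalSpace.mk y s : TangentBundle 𝓘(ℝ, E) E)) w := by
    rw [← contMDiffWithinAt_univ]
    exact contMDiffWithinAt_vectorSpace_iff_contDiffWithinAt.2 contDiffWithinAt_const
  have hmem : {z : TangentBundle 𝓘(ℝ, E) E | z.1 ∈ interior u} ∈
      𝓝 (TotalSpace.mk w s : TangentBundle 𝓘(ℝ, E) E) :=
    (isOpen_interior.preimage (FiberBundle.continuous_proj E (TangentSpace 𝓘(ℝ, E)))).mem_nhds hw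
  have h1 := ContMDiffAt.comp w (g := tangentMapWithin 𝓘(ℝ, E) 𝓘(ℝ, E) Φ (interior u))
    (hT.contMDiffAt hmem) hs
  refine h1.congr_of_eventuallyEq ?_
  filter_upwards [isOpen_interior.mem_nhds hw] with y hy
  simp [tangentMapWithin, mfderivWithin_of_isOpen isOpen_interior hy]

open Bundle in
theorem HermitianMetric.contDiffAt_pullbackForm_apply (g : HermitianMetric E M) {Φ : E → M} {w : E}
    (hΦ : ContMDiffAt 𝓘(ℂ, E) 𝓘(ℂ, E) ω Φ w) (s t : E) :
    ContDiffAt ℝ ∞ (fun w => g.pullbackForm Φ w ![s, t]) w := by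
  have hΦr := hΦ.restrictScalars_real
  have h1 : ContMDiffAt 𝓘(ℝ, E) (𝓘(ℝ, E).prod 𝓘(ℝ)) ∞
      (fun y => TotalSpace.mk' ℝ (E := Bundle.Trivial M ℝ) (Φ y)
        (g.inner (Φ y) (mfderiv 𝓘(ℝ, E) 𝓘(ℝ, E) Φ y (Complex.I • s))
          (mfderiv 𝓘(ℝ, E) 𝓘(ℝ, E) Φ y t))) w := by
    apply ContMDiffAt.clm_bundle_apply₂ (F₁ := E) (F₂ := E)
    · exact g.contMDiff.contMDiffAt.comp w (hΦr.of_le le_top)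
    · exact contMDiffAt_mfderiv_apply_const hΦr _
    · exact contMDiffAt_mfderiv_apply_const hΦr _
  rw [contMDiffAt_totalSpace] at h1
  have h2 := contMDiffAt_iff_contDiffAt.1 h1.2
  have h3 : ∀ᶠ y in 𝓝 w, MDifferentiableAt 𝓘(ℂ, E) 𝓘(ℂ, E) Φ y := by
    obtain ⟨u, hu, hΦu⟩ := (contMDiffAt_iff_contMDiffOn_nhds (by simp)).1 hΦ
    filter_upwards [eventually_eventually_nhds.2 hu] with y hy
    exact (hΦu.contMDiffAt hy).mdifferentiableAt (by simp)
  refine (Complex.ofRealCLM.contDiff.contDiffAt.comp w h2).congr_of_eventuallyEq ?_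
  filter_upwards [h3] with y hy
  rw [g.pullbackForm_apply, ← modelDeriv_smul_I hy]
  rfl

end Pullback

/-! ### The fundamental form in translated coordinates -/

section TranslatedForms

variable {E : Type*} [NormedAddCommGroup E] [NormedSpace ℂ E]
  {G : Type*} [Group G] [TopologicalSpace G] [ChartedSpace E G] [LieGroup 𝓘(ℂ, E) ω G]
  {Γ : Subgroup G} [DiscreteTopology Γ]

/-- The fundamental form of a Hermitian metric on `G ⧸ Γ` read in the coordinate `w ↦ σ w • p`
around `p`, where `σ` is the inverse of the preferred chart of `G` at `1`. -/
def HermitianMetric.translatedForm (g : HermitianMetric E (G ⧸ Γ)) (w : E) (p : G ⧸ Γ) :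
    E [⋀^Fin 2]→L[ℝ] ℂ :=
  g.pullbackForm (fun w => (chartAt E (1 : G)).symm w • p) w

variable (g : HermitianMetric E (G ⧸ Γ))

theorem HermitianMetric.translatedForm_smul_I {w : E} (hw : w ∈ (chartAt E (1 : G)).target)
    (p : G ⧸ Γ) (s t : E) :
    g.translatedForm w p ![Complex.I • s, Complex.I • t] = g.translatedForm w p ![s, t] :=
  g.pullbackForm_smul_I ((contMDiffAt_chartAt_symm_smul Γ p hw).mdifferentiableAt (by simp)) s t

theorem HermitianMetric.contDiffAt_translatedForm [FiniteDimensional ℂ E] {w : E}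
    (hw : w ∈ (chartAt E (1 : G)).target) (p : G ⧸ Γ) :
    ContDiffAt ℝ ∞ (fun w => g.translatedForm w p) w := by
  have : FiniteDimensional ℝ E := FiniteDimensional.complexToReal E
  refine contDiffAt_of_forall_alternatingMap_apply fun v => ?_
  have hv : v = ![v 0, v 1] := by ext i; fin_cases i <;> rfl
  rw [hv]
  exact g.contDiffAt_pullbackForm_apply (contMDiffAt_chartAt_symm_smul Γ p hw) _ _

/-- The SKT condition in translated coordinates. -/
theorem HermitianMetric.IsSKT.formDel_formDelBar_translatedForm {g : HermitianMetric E (G ⧸ Γ)}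
    (hg : g.IsSKT) (p : G ⧸ Γ) :
    formDel (formDelBar fun w => g.translatedForm w p) (chartOne E G) = 0 := by
  have := topologicalGroup_of_lieGroup (G := G) 𝓘(ℂ, E) ω
  obtain ⟨a, rfl⟩ := QuotientGroup.mk_surjective p
  have h := hg _ (rightTranslateChart_mem_maximalAtlas Γ a) _
    (chartOne_mem_rightTranslateChart_target Γ a)
  have hΦ : ((rightTranslateChart (E := E) Γ a).symm : E → G ⧸ Γ) =
      fun w => (chartAt E (1 : G)).symm w • (QuotientGroup.mk a : G ⧸ Γ) :=
    funext fun w => rightTranslateChart_symm_apply Γ a w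
  have h2 : g.fundamentalFormInChart (rightTranslateChart Γ a) =
      g.pullbackForm (rightTranslateChart (E := E) Γ a).symm := rfl
  rw [h2, hΦ] at h
  exact h

theorem tendsto_chartMul : Filter.Tendsto (chartMul E G) (𝓝 (chartOne E G, chartOne E G))
    (𝓝 (chartOne E G)) :=
  isLocalGroupLaw_chartMul.tendsto_mul

/-- How the translated forms change with the base point: changing the base point from `p` to
`σ v • p` amounts to pulling back under the local right translation by `v`. -/
theorem HermitianMetric.translatedForm_smul :
    ∀ᶠ z : E × E in 𝓝 (chartOne E G, chartOne E G), ∀ (p : G ⧸ Γ) (s t : E),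
      g.translatedForm z.1 ((chartAt E (1 : G)).symm z.2 • p) ![s, t] =
        g.translatedForm (chartMul E G z) p
          ![fderivLeft (chartMul E G) z s, fderivLeft (chartMul E G) z t] := by
  filter_upwards [IsSmoothFamilyAt.eventually_eventually_left
      (eventually_chartAt_symm_chartMul (E := E) (G := G)),
    tendsto_chartMul.eventually ((chartAt E (1 : G)).open_target.mem_nhds chartOne_mem_target),
    IsLocalGroupLaw.eventually_differentiableAt (contDiffAt_chartMul.of_le le_top)]
    with z hz hzt hd p s t
  have h1 : (fun w => (chartAt E (1 : G)).symm w • (chartAt E (1 : G)).symm z.2 • p) =ᶠ[𝓝 z.1]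
      fun w => (chartAt E (1 : G)).symm (chartMul E G (w, z.2)) • p := by
    filter_upwards [hz] with w hw
    rw [hw, mul_smul]
  rw [translatedForm, g.pullbackForm_congr h1]
  exact g.pullbackForm_comp (Φ := fun w => (chartAt E (1 : G)).symm w • p)
    ((contMDiffAt_chartAt_symm_smul Γ p hzt).restrictScalars_real.mdifferentiableAt (by simp))
    (hasFDerivAt_fderivLeft hd) s t

/-- The translated forms are a smooth family: for `p = σ v • p₀` near `p₀`, the form at `p` is the
pullback of the form at `p₀` under the local right translation by `v`, which is smooth in `v`. -/
theorem HermitianMetric.isSmoothFamilyAt_translatedForm [FiniteDimensional ℂ E] (n : ℕ) :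
    IsSmoothFamilyAt n g.translatedForm (chartOne E G) := by
  have := topologicalGroup_of_lieGroup (G := G) 𝓘(ℂ, E) ω
  have : FiniteDimensional ℝ E := FiniteDimensional.complexToReal E
  intro p₀
  obtain ⟨a, ha⟩ := QuotientGroup.mk_surjective p₀
  let e := rightTranslateChart (E := E) Γ a
  have he_symm (w : E) : e.symm w = (chartAt E (1 : G)).symm w • p₀ := by
    rw [← ha]; exact rightTranslateChart_symm_apply Γ a w
  have he1 : e.symm (chartOne E G) = p₀ := by rw [he_symm, chartAt_symm_chartOne, one_smul]
  have ht : chartOne E G ∈ e.target := chartOne_mem_rightTranslateChart_target Γ a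
  have hp₀ : p₀ ∈ e.source := by rw [← he1]; exact e.map_target ht
  have hep₀ : e p₀ = chartOne E G := by rw [← he1]; exact e.right_inv ht
  refine ⟨e, fun z => (g.translatedForm (chartMul E G z) p₀).compContinuousLinearMap
    ((fderivLeft (chartMul E G) z).restrictScalars ℝ), ?_, ?_, ?_⟩
  · filter_upwards [e.open_source.mem_nhds hp₀] with p hp using e.continuousAt hp
  · rw [hep₀]
    have hmul : ContDiffAt ℝ n (chartMul E G) (chartOne E G, chartOne E G) :=
      (contDiffAt_chartMul.of_le le_top).restrict_scalars ℝ
    have hD : ContDiffAt ℝ n (fderivLeft (chartMul E G)) (chartOne E G, chartOne E G) :=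
      (ContDiffAt.fderivLeft (n := n) (contDiffAt_chartMul.of_le le_top)).restrict_scalars ℝ
    have hDs (s : E) : ContDiffAt ℝ n (fun z => fderivLeft (chartMul E G) z s)
        (chartOne E G, chartOne E G) :=
      (ContinuousLinearMap.contDiff (ContinuousLinearMap.restrictScalars ℝ
        (ContinuousLinearMap.apply ℂ E s))).contDiffAt.comp _ hD
    have hone : chartMul E G (chartOne E G, chartOne E G) = chartOne E G :=
      isLocalGroupLaw_chartMul.one_mul.self_of_nhds
    have hα : ContDiffAt ℝ n (fun z => g.translatedForm (chartMul E G z) p₀)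
        (chartOne E G, chartOne E G) := by
      refine ContDiffAt.comp _ (g := fun w => g.translatedForm w p₀) ?_ hmul
      rw [hone]
      exact (g.contDiffAt_translatedForm chartOne_mem_target p₀).of_le
        (by exact_mod_cast le_top)
    have hb : ContDiffAt ℝ n (fun z => alternatingTwoCurry (g.translatedForm (chartMul E G z) p₀))
        (chartOne E G, chartOne E G) := by
      refine contDiffAt_clm_of_forall_apply fun s => contDiffAt_clm_of_forall_apply fun t => ?_
      exact (alternatingEvalCLM ![s, t]).contDiff.contDiffAt.comp _ hα
    refine contDiffAt_of_forall_alternatingMap_apply fun v => ?_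
    refine ((hb.clm_apply (hDs (v 0))).clm_apply (hDs (v 1))).congr_of_eventuallyEq
      (.of_forall fun z => ?_)
    refine congrArg (g.translatedForm (chartMul E G z) p₀) ?_
    ext i; fin_cases i <;> rfl
  · have hc : Filter.Tendsto (fun z : E × (G ⧸ Γ) => (z.1, e z.2)) (𝓝 (chartOne E G, p₀))
        (𝓝 (chartOne E G, chartOne E G)) := by
      have := e.continuousAt hp₀
      have h2 : ContinuousAt (fun z : E × (G ⧸ Γ) => (z.1, e z.2)) (chartOne E G, p₀) :=
        continuousAt_fst.prodMk (ContinuousAt.comp (f := Prod.snd) this continuousAt_snd)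
      have h3 := h2.tendsto
      rwa [hep₀] at h3
    filter_upwards [hc.eventually g.translatedForm_smul,
      (continuousAt_snd (p := (chartOne E G, p₀))).eventually (e.open_source.mem_nhds hp₀)]
      with z hz hzs
    refine continuousAlternatingMap_two_ext fun s t => ?_
    have h1 := hz p₀ s t
    rw [← he_symm, e.left_inv hzs] at h1
    rw [h1]
    refine congrArg (g.translatedForm (chartMul E G (z.1, e z.2)) p₀) ?_
    ext i; fin_cases i <;> rfl

end TranslatedForms

/-! ### Averaging the fundamental form -/

section Averaging

open MeasureTheory

variable {E : Type*} [NormedAddCommGroup E] [NormedSpace ℂ E] [FiniteDimensional ℂ E]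
  {G : Type*} [Group G] [TopologicalSpace G] [ChartedSpace E G] [LieGroup 𝓘(ℂ, E) ω G]
  {Γ : Subgroup G} [DiscreteTopology Γ] [CompactSpace (G ⧸ Γ)]

theorem integrable_of_continuous_of_compact {M F : Type*} [TopologicalSpace M] [CompactSpace M]
    [MeasurableSpace M] [BorelSpace M] (m : Measure M) [IsFiniteMeasure m] [NormedAddCommGroup F]
    {f : M → F} (hf : Continuous f) : Integrable f m :=
  hf.integrable_of_hasCompactSupport (HasCompactSupport.of_compactSpace f)

/-- A connected locally compact group is `σ`-compact. -/
theorem sigmaCompactSpace_of_connectedSpace {G : Type*} [Group G] [TopologicalSpace G]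
    [IsTopologicalGroup G] [ConnectedSpace G] [LocallyCompactSpace G] : SigmaCompactSpace G := by
  obtain ⟨K, hK, hK1⟩ := exists_compact_mem_nhds (1 : G)
  let S : Set G := K ∪ K⁻¹
  have hS : IsCompact S := hK.union hK.inv
  have hSinv : S⁻¹ = S := by simp [S, Set.union_comm]
  open Pointwise in
  have hpow (n : ℕ) : IsCompact (S ^ n) := by
    induction n with
    | zero => simp
    | succ n ih => rw [pow_succ]; exact ih.mul hS
  open Pointwise in
  let H : Subgroup G :=
    { carrier := ⋃ n : ℕ, S ^ n
      mul_mem' := by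
        rintro x y hx hy
        obtain ⟨m, hm⟩ := Set.mem_iUnion.1 hx
        obtain ⟨n, hn⟩ := Set.mem_iUnion.1 hy
        exact Set.mem_iUnion.2 ⟨m + n, pow_add S m n ▸ Set.mul_mem_mul hm hn⟩
      one_mem' := Set.mem_iUnion.2 ⟨0, by simp⟩
      inv_mem' := by
        rintro x hx
        obtain ⟨m, hm⟩ := Set.mem_iUnion.1 hx
        refine Set.mem_iUnion.2 ⟨m, ?_⟩
        rw [← hSinv, inv_pow]
        simpa using hm }
  have hH : (H : Set G) ∈ 𝓝 1 := Filter.mem_of_superset hK1 fun x hx =>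
    Set.mem_iUnion.2 ⟨1, by rw [pow_one]; exact Or.inl hx⟩
  have ho : IsOpen (H : Set G) := H.isOpen_of_mem_nhds hH
  have hcl : IsClopen (H : Set G) := ⟨H.isClosed_of_isOpen ho, ho⟩
  exact ⟨⟨_, hpow, hcl.eq_univ ⟨1, H.one_mem⟩⟩⟩

variable (g : HermitianMetric E (G ⧸ Γ)) [MeasurableSpace (G ⧸ Γ)] [BorelSpace (G ⧸ Γ)]
  (m : Measure (G ⧸ Γ)) [IsFiniteMeasure m]

/-- The integral of the translated forms over the base point `p`. It is the integral over `p` of the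
pullbacks of the fundamental form under the orbit maps `x ↦ x • p`, read in the chart at `1`. -/
def HermitianMetric.averagedForm (w : E) : E [⋀^Fin 2]→L[ℝ] ℂ := ∫ p, g.translatedForm w p ∂m

theorem HermitianMetric.averagedForm_apply :
    ∀ᶠ w in 𝓝 (chartOne E G), ∀ v : Fin 2 → E,
      g.averagedForm m w v = ∫ p, g.translatedForm w p v ∂m := by
  filter_upwards [(g.isSmoothFamilyAt_translatedForm 0).eventually_continuous] with w hw v
  exact ((alternatingEvalCLM v).integral_comp_comm
    (integrable_of_continuous_of_compact m hw)).symm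

/-- Averaging preserves `∂∂̄`-closedness, by differentiation under the integral sign. -/
theorem HermitianMetric.IsSKT.formDel_formDelBar_averagedForm {g : HermitianMetric E (G ⧸ Γ)}
    (hg : g.IsSKT) (hc : ContDiffAt ℝ 2 (g.averagedForm m) (chartOne E G)) :
    formDel (formDelBar (g.averagedForm m)) (chartOne E G) = 0 := by
  have hs := g.isSmoothFamilyAt_translatedForm 2
  have hint : Integrable (fun p => fderiv ℝ (fderiv ℝ fun w => g.translatedForm w p)
      (chartOne E G)) m :=
    integrable_of_continuous_of_compact m
      ((hs.fderiv (n := 1)).fderiv (n := 0)).eventually_continuous.self_of_nhds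
  have h2 : fderiv ℝ (fderiv ℝ (g.averagedForm m)) (chartOne E G) = _ :=
    hs.fderiv_fderiv_integral m
  rw [formDel_formDelBar_eq hc, h2, ← (delDelBarCLM E).integral_comp_comm hint]
  refine integral_eq_zero_of_ae (.of_forall fun p => ?_)
  have h3 := hg.formDel_formDelBar_translatedForm p
  rwa [formDel_formDelBar_eq (hs.contDiffAt p)] at h3

/-- The averaged form is invariant under right translations `x ↦ x y`, because these turn the orbit
map of `p` into that of `y • p` and the measure is invariant. -/
theorem HermitianMetric.averagedForm_fderivLeft (hm : ∀ x : G, m.map (x • ·) = m) :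
    ∀ᶠ v in 𝓝 (chartOne E G), ∀ s t, g.averagedForm m v
      ![fderivLeft (chartMul E G) (chartOne E G, v) s,
        fderivLeft (chartMul E G) (chartOne E G, v) t] =
      g.averagedForm m (chartOne E G) ![s, t] := by
  have := topologicalGroup_of_lieGroup (G := G) 𝓘(ℂ, E) ω
  borelize G
  have hs := g.isSmoothFamilyAt_translatedForm 0
  filter_upwards [g.averagedForm_apply m, g.translatedForm_smul.curry_nhds.self_of_nhds,
    (isLocalGroupLaw_chartMul (E := E) (G := G)).one_mul] with v hv h1 h2 s t
  rw [hv, (g.averagedForm_apply m).self_of_nhds]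
  have h3 : ∀ p, g.translatedForm v p ![fderivLeft (chartMul E G) (chartOne E G, v) s,
      fderivLeft (chartMul E G) (chartOne E G, v) t] =
      g.translatedForm (chartOne E G) ((chartAt E (1 : G)).symm v • p) ![s, t] := fun p => by
    rw [h1 p s t, h2]
  simp only [h3]
  have hcont : Continuous fun p => g.translatedForm (chartOne E G) p ![s, t] :=
    (alternatingEvalCLM ![s, t]).continuous.comp hs.eventually_continuous.self_of_nhds
  conv_rhs => rw [← hm ((chartAt E (1 : G)).symm v)]
  refine (integral_map (f := fun p => g.translatedForm (chartOne E G) p ![s, t])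
    (φ := fun p : G ⧸ Γ => (chartAt E (1 : G)).symm v • p)
    (measurable_const_smul _).aemeasurable ?_).symm
  rw [hm]
  exact IsSmoothFamilyAt.aestronglyMeasurable_of_continuous m hcont

omit [FiniteDimensional ℂ E] [CompactSpace (G ⧸ Γ)] [MeasurableSpace (G ⧸ Γ)]
  [BorelSpace (G ⧸ Γ)] in
variable (Γ) in
/-- The orbit map of `p`, read in the chart at `1`, is immersive at the neutral element. -/
theorem modelDeriv_chartAt_symm_smul_injective (p : G ⧸ Γ) : Function.Injective
    (modelDeriv (fun w => (chartAt E (1 : G)).symm w • p) (chartOne E G)) := by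
  have := topologicalGroup_of_lieGroup (G := G) 𝓘(ℂ, E) ω
  obtain ⟨a, rfl⟩ := QuotientGroup.mk_surjective p
  let e := rightTranslateChart (E := E) Γ a
  let Φ : E → G ⧸ Γ := fun w => (chartAt E (1 : G)).symm w • (QuotientGroup.mk a : G ⧸ Γ)
  have he : (e.symm : E → G ⧸ Γ) = Φ := funext fun w => rightTranslateChart_symm_apply Γ a w
  have ho : chartOne E G ∈ e.target := chartOne_mem_rightTranslateChart_target Γ a
  have hΦo : Φ (chartOne E G) ∈ e.source := by rw [← he]; exact e.map_target ho
  have hΦ : MDifferentiableAt 𝓘(ℝ, E) 𝓘(ℝ, E) Φ (chartOne E G) :=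
    (contMDiffAt_chartAt_symm_smul Γ _
      chartOne_mem_target).restrictScalars_real.mdifferentiableAt (by simp)
  have h1 : MDifferentiableAt 𝓘(ℝ, E) 𝓘(ℝ, E) e (Φ (chartOne E G)) :=
    (contMDiffAt_of_mem_maximalAtlas (rightTranslateChart_mem_maximalAtlas Γ a)
      hΦo).restrictScalars_real.mdifferentiableAt (by simp)
  have h2 : e ∘ Φ =ᶠ[𝓝 (chartOne E G)] id := by
    filter_upwards [e.open_target.mem_nhds ho] with w hw
    rw [← he]
    exact e.right_inv hw
  have h3 := (HasMFDerivAt.comp _ h1.hasMFDerivAt hΦ.hasMFDerivAt).congr_of_eventuallyEq h2.symm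
  have h4 := hasMFDerivAt_unique h3 (hasMFDerivAt_id _)
  let L : E →L[ℝ] E := mfderiv 𝓘(ℝ, E) 𝓘(ℝ, E) e (Φ (chartOne E G))
  have h5 (s : E) : L (modelDeriv Φ (chartOne E G) s) = s := congrArg (fun T : E →L[ℝ] E => T s) h4
  exact Function.LeftInverse.injective h5

/-- The averaged form is positive: its value at `(s, is)` is the integral of the squared lengths of
the images of `s` in the tangent spaces of `G ⧸ Γ`. -/
theorem HermitianMetric.averagedForm_self_smul_I_ne_zero (hm0 : m ≠ 0) {s : E} (hs : s ≠ 0) :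
    g.averagedForm m (chartOne E G) ![s, Complex.I • s] ≠ 0 := by
  have := topologicalGroup_of_lieGroup (G := G) 𝓘(ℂ, E) ω
  let D (p : G ⧸ Γ) : E →L[ℝ] E :=
    modelDeriv (fun w => (chartAt E (1 : G)).symm w • p) (chartOne E G)
  have hD (p : G ⧸ Γ) : D p s ≠ 0 := fun h => hs <| modelDeriv_chartAt_symm_smul_injective Γ p
    (h.trans (map_zero _).symm)
  let r (p : G ⧸ Γ) : ℝ :=
    g.modelInner ((chartAt E (1 : G)).symm (chartOne E G) • p) (D p s) (D p s)
  have hr (p : G ⧸ Γ) : 0 < r p := g.pos _ _ (hD p)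
  have h1 (p : G ⧸ Γ) : g.translatedForm (chartOne E G) p ![s, Complex.I • s] = (r p : ℂ) :=
    g.pullbackForm_self_smul_I ((contMDiffAt_chartAt_symm_smul Γ p
      chartOne_mem_target).mdifferentiableAt (by simp)) s
  rw [(g.averagedForm_apply m).self_of_nhds]
  simp only [h1]
  rw [integral_complex_ofReal, Complex.ofReal_ne_zero]
  have hcont : Continuous fun p => g.translatedForm (chartOne E G) p ![s, Complex.I • s] :=
    (alternatingEvalCLM ![s, Complex.I • s]).continuous.comp
      (g.isSmoothFamilyAt_translatedForm 0).eventually_continuous.self_of_nhds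
  have hrc : Continuous r := by
    have : r = fun p => (g.translatedForm (chartOne E G) p ![s, Complex.I • s]).re := by
      funext p; rw [h1, Complex.ofReal_re]
    rw [this]
    exact Complex.continuous_re.comp hcont
  have hpos : 0 < ∫ p, r p ∂m := by
    rw [integral_pos_iff_support_of_nonneg (fun p => (hr p).le)
      (integrable_of_continuous_of_compact m hrc)]
    have : Function.support r = Set.univ := Set.eq_univ_of_forall fun p => (hr p).ne'
    rw [this]
    exact Measure.measure_univ_pos.2 hm0
  exact hpos.ne'

end Averaging

end

set_option maxSynthPendingDepth 3 in
theorem mainTheorem8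
    {E : Type*} [NormedAddCommGroup E] [NormedSpace ℂ E] [FiniteDimensional ℂ E]
    {G : Type*} [Group G] [TopologicalSpace G] [ChartedSpace E G] [LieGroup 𝓘(ℂ, E) ω G]
    [SimplyConnectedSpace G] [Group.IsSolvable G]
    (Γ : Subgroup G) [DiscreteTopology Γ] [CompactSpace (G ⧸ Γ)]
    (hG : ¬ Group.IsNilpotent G) :
    ¬ ∃ g : HermitianMetric E (G ⧸ Γ), g.IsSKT := by
  rintro ⟨g, hg⟩
  have := topologicalGroup_of_lieGroup (G := G) 𝓘(ℂ, E) ω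
  have : ProperSpace E := FiniteDimensional.proper ℂ E
  have : LocallyCompactSpace G := ChartedSpace.locallyCompactSpace E G
  have : SigmaCompactSpace G := sigmaCompactSpace_of_connectedSpace
  have : SecondCountableTopology G := ChartedSpace.secondCountable_of_sigmaCompact E G
  have : CompleteSpace E := FiniteDimensional.complete ℂ E
  borelize (G ⧸ Γ)
  obtain ⟨m, hmfin, hm0, hm⟩ := exists_finite_smulInvariant_measure Γ
  let o := chartOne E G
  let R : E → E →L[ℂ] E := fun v => fderivLeft (chartMul E G) (o, v)
  have hlaw := isLocalGroupLaw_chartMul (E := E) (G := G)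
  have hRo : R o = 1 := hlaw.fderivLeft_mul_one.self_of_nhds
  have hR : ContDiffAt ℂ 2 R o :=
    ContDiffAt.comp (g := fderivLeft (chartMul E G)) (f := fun x => (o, x)) o
      (ContDiffAt.fderivLeft (n := 2) (contDiffAt_chartMul.of_le le_top))
      (contDiffAt_const.prodMk contDiffAt_id)
  -- in the frame of right invariant vector fields the averaged form has constant coefficients
  let A : E → E →L[ℂ] E := fun v => Ring.inverse (R v)
  have hAo : A o = 1 := by simp [A, hRo]
  have hA : ContDiffAt ℂ 2 A o := by
    refine ContDiffAt.comp o (g := Ring.inverse) ?_ hR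
    rw [hRo]
    exact contDiffAt_ringInverse ℂ (1 : (E →L[ℂ] E)ˣ)
  have hα : ∀ᶠ v in 𝓝 o, ∀ s t, g.averagedForm m v ![s, t] =
      g.averagedForm m o ![A v s, A v t] := by
    filter_upwards [g.averagedForm_fderivLeft m hm, hlaw.isInvertible_fderivLeft_mul]
      with v hv hu s t
    have hRA (s : E) : R v (A v s) = s :=
      congrArg (fun L : E →L[ℂ] E => L s) (Ring.mul_inverse_cancel (R v) hu)
    rw [← hv (A v s) (A v t)]
    change _ = g.averagedForm m v ![R v (A v s), R v (A v t)]
    rw [hRA, hRA]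
  have hB (s t : E) : g.averagedForm m o ![Complex.I • s, Complex.I • t] =
      g.averagedForm m o ![s, t] := by
    change g.averagedForm m (chartOne E G) _ = g.averagedForm m (chartOne E G) _
    simp only [(g.averagedForm_apply m).self_of_nhds]
    simp only [g.translatedForm_smul_I chartOne_mem_target]
  have h0 := hg.formDel_formDelBar_averagedForm m (contDiffAt_of_eventually_apply_eq hA hα)
  -- the torsion of the frame `A` vanishes, since the averaged form is `∂∂̄`-closed and positive
  have htors (u v : E) : fderiv ℂ A o u v = fderiv ℂ A o v u := by
    by_contra hne
    have h1 := formDel_formDelBar_of_holomorphic hA hAo hB hα u v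
    rw [h0] at h1
    refine g.averagedForm_self_smul_I_ne_zero m hm0 (sub_ne_zero.2 hne) ?_
    have h2 : (2 * Complex.I) ≠ 0 := by simp
    exact (mul_eq_zero.1 h1.symm).resolve_left h2
  -- hence the second order term of the group law is symmetric
  have hdA : fderiv ℂ A o = -fderiv ℂ R o := by
    have hRd := (hR.differentiableAt (by norm_num)).hasFDerivAt
    have h1 : HasFDerivAt A _ o := HasFDerivAt.comp (g := Ring.inverse) o (by
      rw [hRo]; exact hasFDerivAt_ringInverse (𝕜 := ℂ) (1 : (E →L[ℂ] E)ˣ)) hRd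
    rw [h1.fderiv]
    ext u v
    rfl
  have hcomm := mul_comm_of_symm (E := E) (G := G) fun u v => by
    have := htors u v
    rw [hdA] at this
    simpa using this
  exact hG (@CommGroup.isNilpotent G { ‹Group G› with mul_comm := hcomm })
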